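/- Let $n\ge 2$ and let $f(\cdot\,;\theta)$, $\theta\ge 0$, be strictly positive probability densities on $\mathbb R$ such that $f(x;0)=\phi(x)=(2\pi)^{-1/2}e^{-x^2/2}$ and, for every $x$, $\theta\mapsto \log f(x;\theta)$ is continuously differentiable on $[0,\infty)$ (one-sided at $\theta=0$). Put $f_{a,b}(x;\theta)=\frac1b f\big(\frac{x-a}{b};\theta\big)$ for $a\in\mathbb R$, $b>0$, and $l_\theta(x;0)=\frac{\partial}{\partial\theta}\log f(x;\theta)\big|_{\theta=0}$. Based on i.i.d. observations $x_1,\dots,x_n$ from $f_{a,b}(\cdot\,;\theta)$ with $a,b$ unknown, consider testing $H_0:\theta=0$ (normality) against $H_1:\theta>0$ by tests invariant under $x_i\mapsto a+bx_i$ ($a\in\mathbb R$, $b>0$). Let $z_i=(x_i-\bar x)/s$ with $\bar x=\frac1n\sum_j x_j$ and $s^2=\frac1n\sum_{j}(x_j-\bar x)^2$. Assume that for some $\epsilon>0$ $$\int_0^\infty\!\int_{-\infty}^\infty g(a,b;\epsilon)^n\, e^{-n(a^2+b^2)/2}\, b^{n-2}\,da\,db<\infty,\qquad g(a,b;\epsilon)=\sup_{|z|\le\sqrt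 n,\ 0\le\theta\le\epsilon}\frac{\big|\frac{\partial}{\partial\theta}f(a+bz;\theta)\big|}{f(a+bz;0)}.$$ Then the integral $$T(z_1,\dots,z_n)=\int_0^\infty\!\int_{-\infty}^\infty \sum_{i=1}^n l_\theta(a+bz_i;0)\, e^{-n(a^2+b^2)/2}\, b^{n-2}\,da\,db$$ converges absolutely. Let $k\in\mathbb R$ be such that $T(z_1,\dots,z_n)=k$ has probability $0$ under $H_0$, and let $\alpha$ be the probability of $T(z_1,\dots,z_n)>k$ under $H_0$ (probabilities under $H_0$ of invariant events do not depend on $a,b$). Then the region $\{T(z_1,\dots,z_n)>k\}$ is, up to Lebesgue null sets, the unique locally best invariant test of $H_0$ against $H_1$ of level $\alpha$, both among invariant critical regions and among invariant randomized tests. Here locally best is meant in both usual senses, and existence and uniqueness hold in each: (i) the test has level $\alpha$ and for each competing invariant test of level $\alpha$ there is $\delta>0$ such that its power is at least that of the competitor at $f_{a,b}(\cdot\,;\theta)$ for all $0<\theta<\delta$, $a\in\mathbb R$, $b>0$; (ii) among the invariant tests of size exactly $\alpha$, whose power functions are all differentiable in $\theta$ from the right at $\theta=0$, it maximizes the slope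 of the power function at $\theta=0$. -/

import Mathlib

open MeasureTheory ProbabilityTheory Set
open scoped ENNReal

noncomputable section

/-- The location-scale density `f_{a,b}(x;θ) = (1/b) f((x-a)/b; θ)`; here `f x θ` is the value at
`x` of the standard density with shape parameter `θ`. -/
def locScaleDensity (f : ℝ → ℝ → ℝ) (θ a b x : ℝ) : ℝ := 1 / b * f ((x - a) / b) θ

/-- The joint law of `n` i.i.d. observations with density `f_{a,b}(·;θ)`. -/
def sampleLaw (f : ℝ → ℝ → ℝ) (n : ℕ) (θ a b : ℝ) : Measure (Fin n → ℝ) :=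
  Measure.pi fun _ => volume.withDensity fun x => ENNReal.ofReal (locScaleDensity f θ a b x)

/-- The partial derivative of the density in `θ` on `[0,∞)` (one-sided at `θ = 0`). -/
def densityDeriv (f : ℝ → ℝ → ℝ) (x θ : ℝ) : ℝ := derivWithin (fun t => f x t) (Ici 0) θ

/-- The score function: the derivative of `log f(x;θ)` in `θ` on `[0,∞)` (one-sided at `0`). -/
def score (f : ℝ → ℝ → ℝ) (x θ : ℝ) : ℝ :=
  derivWithin (fun t => Real.log (f x t)) (Ici 0) θ

/-- The weight `exp(-n(a²+b²)/2) b^{n-2}` (used for `n ≥ 2`). -/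
def weight (n : ℕ) (a b : ℝ) : ℝ := Real.exp (-(n * (a ^ 2 + b ^ 2) / 2)) * b ^ (n - 2)

/-- The supremum, possibly infinite, of `|∂f/∂θ (a+bz;θ)| / f(a+bz;0)` over `|z| ≤ √n` and
`0 ≤ θ ≤ ε`. -/
def scoreSup (f : ℝ → ℝ → ℝ) (n : ℕ) (ε a b : ℝ) : ℝ≥0∞ :=
  ⨆ (z : ℝ) (_ : |z| ≤ Real.sqrt n) (θ : ℝ) (_ : θ ∈ Icc 0 ε),
    ENNReal.ofReal (|densityDeriv f (a + b * z) θ| / f (a + b * z) 0)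

/-- The integrability condition on the family. -/
def ScoreIntegrability (f : ℝ → ℝ → ℝ) (n : ℕ) : Prop :=
  ∃ ε : ℝ, 0 < ε ∧
    ∫⁻ b in Ioi (0 : ℝ), ∫⁻ a : ℝ, scoreSup f n ε a b ^ n * ENNReal.ofReal (weight n a b) < ∞

/-- Sample mean. -/
def sampleMean {n : ℕ} (x : Fin n → ℝ) : ℝ := (∑ i, x i) / n

/-- Sample standard deviation, with divisor `n`. -/
def sampleSD {n : ℕ} (x : Fin n → ℝ) : ℝ :=
  Real.sqrt ((∑ j, (x j - sampleMean x) ^ 2) / n)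

/-- Standardized observations. (The null set of constant samples is sent to `0`.) -/
def standardize {n : ℕ} (x : Fin n → ℝ) : Fin n → ℝ := fun i => (x i - sampleMean x) / sampleSD x

/-- The statistic `T(z₁,…,zₙ)`. -/
def lbiStat (f : ℝ → ℝ → ℝ) {n : ℕ} (z : Fin n → ℝ) : ℝ :=
  ∫ b in Ioi (0 : ℝ), ∫ a : ℝ, (∑ i, score f (a + b * z i) 0) * weight n a b

/-- The critical region `T(z₁,…,zₙ) > k`, as a set of samples. -/
def lbiRegion (f : ℝ → ℝ → ℝ) (n : ℕ) (k : ℝ) : Set (Fin n → ℝ) :=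
  {x | k < lbiStat f (standardize x)}

/-- The critical function of a (nonrandomized) critical region. -/
def regionTest {n : ℕ} (R : Set (Fin n → ℝ)) : (Fin n → ℝ) → ℝ := R.indicator fun _ => 1

/-- Measurable critical functions (randomized tests) that are invariant under
`x ↦ a + b x`, `a` real, `b > 0`. -/
def invariantTests (n : ℕ) : Set ((Fin n → ℝ) → ℝ) :=
  {φ | Measurable φ ∧ (∀ x, φ x ∈ Icc (0 : ℝ) 1) ∧
    ∀ (a b : ℝ), 0 < b → ∀ x, φ (fun i => a + b * x i) = φ x}

/-- Critical functions of measurable critical regions that are invariant under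
`x ↦ a + b x`, `a` real, `b > 0`. -/
def invariantRegionTests (n : ℕ) : Set ((Fin n → ℝ) → ℝ) :=
  {φ | ∃ R : Set (Fin n → ℝ), MeasurableSet R ∧
    (∀ (a b : ℝ), 0 < b → ∀ x, x ∈ R ↔ (fun i => a + b * x i) ∈ R) ∧ φ = regionTest R}

/-- Power function: the probability of rejection under `f_{a,b}(·;θ)`. -/
def power (f : ℝ → ℝ → ℝ) {n : ℕ} (φ : (Fin n → ℝ) → ℝ) (θ a b : ℝ) : ℝ :=
  ∫ x, φ x ∂(sampleLaw f n θ a b)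

/-- `φ` has level `α` for the composite null hypothesis `θ = 0`. -/
def HasLevel (f : ℝ → ℝ → ℝ) {n : ℕ} (α : ℝ) (φ : (Fin n → ℝ) → ℝ) : Prop :=
  ∀ a b : ℝ, 0 < b → power f φ 0 a b ≤ α

/-- `φ` is similar of exact size `α` for the composite null hypothesis `θ = 0`. -/
def HasExactSize (f : ℝ → ℝ → ℝ) {n : ℕ} (α : ℝ) (φ : (Fin n → ℝ) → ℝ) : Prop :=
  ∀ a b : ℝ, 0 < b → power f φ 0 a b = α

/-- `φ` is locally best of level `α` in the class `C` of tests of `θ = 0` against `θ > 0`: it has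
level `α` and is at least as powerful as any other level `α` test of the class, for all
alternatives close enough to `θ = 0` (how close may depend on the competitor). -/
def IsLocallyBest (f : ℝ → ℝ → ℝ) {n : ℕ} (C : Set ((Fin n → ℝ) → ℝ)) (α : ℝ)
    (φ : (Fin n → ℝ) → ℝ) : Prop :=
  φ ∈ C ∧ HasLevel f α φ ∧
    ∀ ψ ∈ C, HasLevel f α ψ →
      ∃ δ : ℝ, 0 < δ ∧ ∀ θ ∈ Ioo 0 δ, ∀ a b : ℝ, 0 < b → power f ψ θ a b ≤ power f φ θ a b

/-- `φ` is locally best of size `α` in the class `C` in the sense of slopes: among the tests in `C`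
of exact size `α`, all of which have power functions differentiable from the right at `θ = 0`,
it maximizes the slope of the power function at `θ = 0`. -/
def IsSlopeBest (f : ℝ → ℝ → ℝ) {n : ℕ} (C : Set ((Fin n → ℝ) → ℝ)) (α : ℝ)
    (φ : (Fin n → ℝ) → ℝ) : Prop :=
  φ ∈ C ∧ HasExactSize f α φ ∧
    ∀ ψ ∈ C, HasExactSize f α ψ → ∀ a b : ℝ, 0 < b →
      ∃ dφ dψ : ℝ, HasDerivWithinAt (fun θ => power f φ θ a b) dφ (Ici 0) 0 ∧
        HasDerivWithinAt (fun θ => power f ψ θ a b) dψ (Ici 0) 0 ∧ dψ ≤ dφ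

end

open Filter Topology

/-! An invariant test has a power that does not depend on `(a, b)`, so the composite problem becomes
a simple one as soon as the density ratio of the maximal invariant is known.
`lintegral_mul_likelihood_eq` supplies it in Wijsman's form: averaging the likelihood ratio over the
affine orbit of the standardized sample `z` gives that ratio. Since `∑ (a + b zᵢ)² = n (a² + b²)`,
the normal density along the orbit depends on `(a, b)` only, and `weight` is this density, up to a
constant, times the factor `b ^ (n - 2)`. No quotient space is needed: Tonelli's theorem and the
inversion `(a, b) ↦ (-a/b, 1/b)` suffice.

Hence (`power_mul_orbitMeasure`) the power times the mass `W` of `orbitMeasure` is the integral of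
`φ` times a product of ratios `f(·;θ) / f(·;0)` against a measure free of `θ`. If `G` bounds the
`θ`-derivative of one ratio, the product differs from 1 by at most `θ (1 + G) ^ n`, and the `n`-th
power in the integrability condition makes this bound integrable. Dominated convergence then gives
the slope `E₀[φ T] / W` (`hasDerivWithinAt_power`).

It remains to maximize `E₀[φ T]` at fixed `E₀[φ]`, which is the Neyman–Pearson lemma
(`integral_mul_lbiStat_lt_or_ae_eq`). Since `T ≠ k` almost surely, equality forces equality of the
tests almost everywhere. So every competitor that is not almost everywhere equal has either a
smaller size or a strictly smaller slope, and is strictly less powerful near `θ = 0`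
(`ae_eq_or_power_lt`). This gives existence and uniqueness in both senses. -/

/-! ### Affine substitutions on the sample space and the joint density. -/

theorem lintegral_pi_eq_lintegral_affine {n : ℕ} (a : ℝ) {b : ℝ} (hb : 0 < b)
    {F : (Fin n → ℝ) → ℝ≥0∞} (hF : Measurable F) :
    ∫⁻ x, F x = ENNReal.ofReal (b ^ n) * ∫⁻ x : Fin n → ℝ, F (fun i => a + b * x i) := by
  have h1 : ∫⁻ x : Fin n → ℝ, F (fun i => a + b * x i) =
      ∫⁻ y, F ((fun _ => a) + y) ∂(Measure.map (b • ·) (volume : Measure (Fin n → ℝ))) := by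
    rw [lintegral_map (by fun_prop) (measurable_const_smul b)]
    rfl
  rw [h1, Measure.map_addHaar_smul _ hb.ne', lintegral_smul_measure,
    lintegral_add_left_eq_self (μ := volume) F, smul_eq_mul, ← mul_assoc,
    ← ENNReal.ofReal_mul (by positivity)]
  have : b ^ n * |(b ^ Module.finrank ℝ (Fin n → ℝ))⁻¹| = 1 := by
    rw [Module.finrank_fin_fun, abs_of_pos (by positivity)]
    field_simp
  rw [this, ENNReal.ofReal_one, one_mul]

/-- Both measures agree on boxes. The factorization there comes from the product formula for
real-valued integrals, whence the integrability of `g`. -/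
theorem pi_withDensity_ofReal {ι : Type*} [Fintype ι] {g : ℝ → ℝ}
    (h0 : ∀ x, 0 ≤ g x) (hi : Integrable g) :
    Measure.pi (fun _ : ι => volume.withDensity fun x => ENNReal.ofReal (g x)) =
      volume.withDensity fun x : ι → ℝ => ∏ i, ENNReal.ofReal (g (x i)) := by
  refine Measure.pi_eq fun s hs => ?_
  have hg : ∀ i, Integrable ((s i).indicator g) := fun i => hi.indicator (hs i)
  have hg0 : ∀ i x, 0 ≤ (s i).indicator g x := fun i x => indicator_nonneg (fun y _ => h0 y) x
  have hprod : ∀ x : ι → ℝ, (univ.pi s).indicator (fun x => ∏ i, ENNReal.ofReal (g (x i))) x =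
      ENNReal.ofReal (∏ i, (s i).indicator g (x i)) := by
    intro x
    rw [ENNReal.ofReal_prod_of_nonneg fun i _ => hg0 i _]
    by_cases hx : x ∈ univ.pi s
    · rw [indicator_of_mem hx]
      exact Finset.prod_congr rfl fun i _ => by rw [indicator_of_mem (hx i (mem_univ i))]
    · rw [indicator_of_notMem hx]
      simp only [mem_univ_pi, not_forall] at hx
      obtain ⟨i, hi'⟩ := hx
      exact (Finset.prod_eq_zero (Finset.mem_univ i) (by simp [hi'])).symm
  rw [withDensity_apply _ (MeasurableSet.univ_pi hs), ← lintegral_indicator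
    (MeasurableSet.univ_pi hs)]
  simp_rw [hprod]
  rw [volume_pi, ← ofReal_integral_eq_lintegral_ofReal (Integrable.fintype_prod hg)
    (Filter.Eventually.of_forall fun x => Finset.prod_nonneg fun i _ => hg0 i _),
    integral_fintype_prod_eq_prod (fun i => (s i).indicator g),
    ENNReal.ofReal_prod_of_nonneg fun i _ => integral_nonneg (hg0 i)]
  refine Finset.prod_congr rfl fun i _ => ?_
  rw [ofReal_integral_eq_lintegral_ofReal (hg i) (Filter.Eventually.of_forall (hg0 i)),
    withDensity_apply _ (hs i), ← lintegral_indicator (hs i)]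
  refine lintegral_congr fun x => ?_
  by_cases hx : x ∈ s i <;> simp [hx]

section LocationScale

variable {f : ℝ → ℝ → ℝ} {n : ℕ} {θ a b : ℝ}

theorem sampleLaw_eq_withDensity (hm : Measurable fun x => f x θ) (h0 : ∀ x, 0 < f x θ)
    (h1 : ∫⁻ x, ENNReal.ofReal (f x θ) = 1) (hb : 0 < b) :
    sampleLaw f n θ a b = volume.withDensity fun x : Fin n → ℝ =>
      ∏ i, ENNReal.ofReal (locScaleDensity f θ a b (x i)) := by
  have hi : Integrable fun x => f x θ := by
    refine ⟨hm.aestronglyMeasurable, ?_⟩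
    rw [hasFiniteIntegral_iff_ofReal (Filter.Eventually.of_forall fun x => (h0 x).le), h1]
    exact ENNReal.one_lt_top
  unfold sampleLaw
  refine pi_withDensity_ofReal (fun x => ?_) ?_
  · have := h0 ((x - a) / b)
    unfold locScaleDensity
    positivity
  · unfold locScaleDensity
    exact ((hi.comp_div hb.ne').comp_sub_right a).const_mul _

/-- The substitution `x ↦ a + b x` has Jacobian `b ^ n`, which cancels the factors `1 / b` of the
`n` densities. This is what makes the power of an invariant test free of `(a, b)`. -/
theorem lintegral_sampleLaw_of_invariant (hm : Measurable fun x => f x θ) (h0 : ∀ x, 0 < f x θ)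
    (h1 : ∫⁻ x, ENNReal.ofReal (f x θ) = 1) (hb : 0 < b) {F : (Fin n → ℝ) → ℝ≥0∞}
    (hF : Measurable F) (hinv : ∀ a b : ℝ, 0 < b → ∀ x, F (fun i => a + b * x i) = F x) :
    ∫⁻ x, F x ∂sampleLaw f n θ a b = ∫⁻ x, F x * ∏ i, ENNReal.ofReal (f (x i) θ) := by
  have hm' : Measurable fun x : Fin n → ℝ =>
      ∏ i, ENNReal.ofReal (locScaleDensity f θ a b (x i)) := by
    unfold locScaleDensity
    refine Finset.measurable_prod _ fun i _ => ENNReal.measurable_ofReal.comp ?_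
    exact (hm.comp (g := fun x => f x θ)
      (by fun_prop : Measurable fun x : Fin n → ℝ => (x i - a) / b)).const_mul _
  rw [sampleLaw_eq_withDensity hm h0 h1 hb, lintegral_withDensity_eq_lintegral_mul _ hm' hF,
    lintegral_pi_eq_lintegral_affine a hb (hm'.mul hF), ← lintegral_const_mul' _ _ (by simp)]
  refine lintegral_congr fun x => ?_
  have : ∀ i, locScaleDensity f θ a b (a + b * x i) = 1 / b * f (x i) θ := by
    intro i
    unfold locScaleDensity
    congr 2
    field_simp
    ring
  simp only [Pi.mul_apply, hinv a b hb, this]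
  rw [mul_comm _ (F x), mul_left_comm]
  congr 1
  simp_rw [ENNReal.ofReal_mul (show 0 ≤ 1 / b by positivity)]
  rw [Finset.prod_mul_distrib, Finset.prod_const, Finset.card_fin, ← mul_assoc,
    ← ENNReal.ofReal_pow (by positivity), ← ENNReal.ofReal_mul (by positivity)]
  have : b ^ n * (1 / b) ^ n = 1 := by
    rw [← mul_pow, mul_one_div_cancel hb.ne', one_pow]
  rw [this, ENNReal.ofReal_one, one_mul]

end LocationScale

/-! ### The standardized sample. -/

section Standardize

variable {n : ℕ}

theorem sampleMean_affine (hn : n ≠ 0) (a b : ℝ) (x : Fin n → ℝ) :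
    sampleMean (fun i => a + b * x i) = a + b * sampleMean x := by
  have : (n : ℝ) ≠ 0 := Nat.cast_ne_zero.2 hn
  simp only [sampleMean, Finset.sum_add_distrib, Finset.sum_const, Finset.card_fin, nsmul_eq_mul,
    ← Finset.mul_sum]
  field_simp

theorem sampleSD_affine (hn : n ≠ 0) (a : ℝ) {b : ℝ} (hb : 0 < b) (x : Fin n → ℝ) :
    sampleSD (fun i => a + b * x i) = b * sampleSD x := by
  have h : ∀ j, (a + b * x j - (a + b * sampleMean x)) ^ 2 = b ^ 2 * (x j - sampleMean x) ^ 2 :=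
    fun j => by ring
  simp only [sampleSD, sampleMean_affine hn, h, ← Finset.mul_sum]
  rw [mul_div_assoc, Real.sqrt_mul (by positivity), Real.sqrt_sq hb.le]

theorem standardize_affine (hn : n ≠ 0) (a : ℝ) {b : ℝ} (hb : 0 < b) (x : Fin n → ℝ) :
    standardize (fun i => a + b * x i) = standardize x := by
  ext i
  simp only [standardize, sampleMean_affine hn, sampleSD_affine hn a hb]
  rw [← mul_div_mul_left (x i - sampleMean x) (sampleSD x) hb.ne']
  ring_nf

theorem sum_standardize (x : Fin n → ℝ) : ∑ i, standardize x i = 0 := by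
  rcases Nat.eq_zero_or_pos n with rfl | hn
  · simp
  have : (n : ℝ) ≠ 0 := by positivity
  simp only [standardize, ← Finset.sum_div, Finset.sum_sub_distrib, Finset.sum_const,
    Finset.card_fin, nsmul_eq_mul]
  rw [sampleMean, mul_div_cancel₀ _ this, sub_self, zero_div]

theorem sampleSD_nonneg (x : Fin n → ℝ) : 0 ≤ sampleSD x := Real.sqrt_nonneg _

theorem sum_standardize_sq {x : Fin n → ℝ} (hx : sampleSD x ≠ 0) :
    ∑ i, standardize x i ^ 2 = n := by
  have h := Real.sq_sqrt (show 0 ≤ (∑ j, (x j - sampleMean x) ^ 2) / n by positivity)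
  change sampleSD x ^ 2 = _ at h
  have hn : (n : ℝ) ≠ 0 := by
    rintro h0
    rw [h0, div_zero] at h
    exact hx (pow_eq_zero_iff two_ne_zero |>.1 h)
  simp only [standardize, div_pow, ← Finset.sum_div]
  rw [div_eq_iff (pow_ne_zero 2 hx), h]
  field_simp

theorem sum_affine_standardize_sq {x : Fin n → ℝ} (hx : sampleSD x ≠ 0) (a b : ℝ) :
    ∑ i, (a + b * standardize x i) ^ 2 = n * (a ^ 2 + b ^ 2) := by
  have h : ∀ i, (a + b * standardize x i) ^ 2 =
      a ^ 2 + 2 * a * b * standardize x i + b ^ 2 * standardize x i ^ 2 := fun i => by ring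
  simp only [h, Finset.sum_add_distrib, ← Finset.mul_sum, sum_standardize, sum_standardize_sq hx,
    Finset.sum_const, Finset.card_fin, nsmul_eq_mul]
  ring

theorem affine_eq_affine_standardize {x : Fin n → ℝ} (hx : sampleSD x ≠ 0) (a b : ℝ) (i : Fin n) :
    a + b * x i = (a + b * sampleMean x) + (b * sampleSD x) * standardize x i := by
  simp only [standardize]
  field_simp
  ring

/-- If one coordinate used up the whole sum of squares `n`, the others would vanish, and then so
would this one, because the sum is 0. Strictness matters: it allows an open, hence measurable,
version of the supremum over `|z| ≤ √n`. -/
theorem abs_standardize_lt (hn : 2 ≤ n) (x : Fin n → ℝ) (i : Fin n) :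
    |standardize x i| < Real.sqrt n := by
  have hn0 : (0 : ℝ) < n := by positivity
  by_cases hx : sampleSD x = 0
  · simp only [standardize, hx, div_zero, abs_zero]
    exact Real.sqrt_pos.2 hn0
  have hsq := sum_standardize_sq hx
  have hsum := sum_standardize x
  rw [← Finset.add_sum_erase _ _ (Finset.mem_univ i)] at hsq hsum
  rw [Real.lt_sqrt (abs_nonneg _), sq_abs]
  by_contra! hlt
  have hnn : 0 ≤ ∑ j ∈ Finset.univ.erase i, standardize x j ^ 2 :=
    Finset.sum_nonneg fun j _ => sq_nonneg _
  have hz : ∑ j ∈ Finset.univ.erase i, standardize x j ^ 2 = 0 := by linarith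
  rw [Finset.sum_eq_zero_iff_of_nonneg fun j _ => sq_nonneg _] at hz
  have hz' : ∑ j ∈ Finset.univ.erase i, standardize x j = 0 :=
    Finset.sum_eq_zero fun j hj => pow_eq_zero_iff two_ne_zero |>.1 (hz j hj)
  rw [hz', add_zero] at hsum
  rw [hsum] at hlt
  linarith

theorem measurable_sampleMean : Measurable (sampleMean : (Fin n → ℝ) → ℝ) := by
  unfold sampleMean; fun_prop

theorem measurable_sampleSD : Measurable (sampleSD : (Fin n → ℝ) → ℝ) := by
  have := measurable_sampleMean (n := n)
  unfold sampleSD; fun_prop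

theorem measurable_standardize : Measurable (standardize : (Fin n → ℝ) → Fin n → ℝ) := by
  have := measurable_sampleMean (n := n)
  have := measurable_sampleSD (n := n)
  unfold standardize; fun_prop

/-- Samples of zero deviation are constant, so they lie in the hyperplane where the first two
coordinates agree. -/
theorem ae_sampleSD_ne_zero (hn : 2 ≤ n) : ∀ᵐ x : Fin n → ℝ, sampleSD x ≠ 0 := by
  let i : Fin n := ⟨0, by omega⟩
  let j : Fin n := ⟨1, by omega⟩
  have hij : i ≠ j := by simp [i, j]
  let ℓ : (Fin n → ℝ) →ₗ[ℝ] ℝ := 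
    LinearMap.proj (R := ℝ) (φ := fun _ => ℝ) i - LinearMap.proj (R := ℝ) (φ := fun _ => ℝ) j
  have hne : LinearMap.ker ℓ ≠ ⊤ := by
    intro h
    have : Pi.single i (1 : ℝ) ∈ LinearMap.ker ℓ := h ▸ Submodule.mem_top
    simp [ℓ, hij.symm] at this
  refine measure_mono_null ?_ (Measure.addHaar_submodule volume _ hne)
  intro x hx
  have hx : sampleSD x = 0 := by simpa using hx
  have h0 : (∑ k, (x k - sampleMean x) ^ 2) / n = 0 := by
    rwa [sampleSD, Real.sqrt_eq_zero (by positivity)] at hx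
  have hn0 : (n : ℝ) ≠ 0 := by positivity
  rw [div_eq_zero_iff, or_iff_left hn0, Finset.sum_eq_zero_iff_of_nonneg fun k _ => sq_nonneg _]
    at h0
  have hk : ∀ k, x k = sampleMean x := fun k => by
    have := pow_eq_zero_iff two_ne_zero |>.1 (h0 k (Finset.mem_univ k))
    linarith
  simp [ℓ, hk i, hk j]

end Standardize

/-! ### Substitutions in the orbit parameters. -/

theorem lintegral_eq_lintegral_affine {c : ℝ} (hc : c ≠ 0) (m : ℝ) (G : ℝ → ℝ≥0∞) :
    ∫⁻ a, G a = ENNReal.ofReal |c| * ∫⁻ a, G (m + c * a) := by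
  have himg : (fun a : ℝ => m + c * a) '' univ = univ := by
    rw [image_univ]
    exact Function.Surjective.range_eq fun y => ⟨(y - m) / c, by field_simp; ring⟩
  have := lintegral_image_eq_lintegral_abs_deriv_mul (s := univ) (f := fun a : ℝ => m + c * a)
    (f' := fun _ => c) MeasurableSet.univ
    (fun x _ => by
      simpa using (((hasDerivAt_id x).const_mul c).const_add m).hasDerivWithinAt (s := univ))
    (fun x _ y _ h => by simpa [hc] using h) G
  rw [himg, Measure.restrict_univ] at this
  rw [this, lintegral_const_mul' _ _ ENNReal.ofReal_ne_top]

theorem lintegral_Ioi_eq_lintegral_mul {s : ℝ} (hs : 0 < s) (G : ℝ → ℝ≥0∞) :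
    ∫⁻ b in Ioi 0, G b = ENNReal.ofReal s * ∫⁻ b in Ioi 0, G (s * b) := by
  have himg : (fun b : ℝ => s * b) '' Ioi 0 = Ioi 0 := by
    ext y
    refine ⟨?_, fun hy => ⟨y / s, div_pos hy hs, by field_simp⟩⟩
    rintro ⟨b, hb, rfl⟩
    exact mul_pos hs hb
  have := lintegral_image_eq_lintegral_abs_deriv_mul (s := Ioi 0) (f := fun b : ℝ => s * b)
    (f' := fun _ => s) measurableSet_Ioi
    (fun x _ => by simpa using ((hasDerivAt_id x).const_mul s).hasDerivWithinAt)
    (fun x _ y _ h => by simpa [hs.ne'] using h) G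
  rw [himg] at this
  rw [this, lintegral_const_mul' _ _ ENNReal.ofReal_ne_top, abs_of_pos hs]

theorem lintegral_Ioi_eq_lintegral_div {s : ℝ} (hs : 0 < s) (G : ℝ → ℝ≥0∞) :
    ∫⁻ b in Ioi 0, G b = ∫⁻ b in Ioi 0, ENNReal.ofReal (s / b ^ 2) * G (s / b) := by
  have himg : (fun b : ℝ => s / b) '' Ioi 0 = Ioi 0 := by
    ext y
    refine ⟨?_, fun hy => ⟨s / y, div_pos hs hy, by have : y ≠ 0 := ne_of_gt hy; field_simp⟩⟩
    rintro ⟨b, hb, rfl⟩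
    exact div_pos hs hb
  have := lintegral_image_eq_lintegral_abs_deriv_mul (s := Ioi 0) (f := fun b : ℝ => s / b)
    (f' := fun b => -(s / b ^ 2)) measurableSet_Ioi
    (fun x hx => by
      have := ((hasDerivAt_inv (ne_of_gt hx)).const_mul s).hasDerivWithinAt (s := Ioi 0)
      simpa [div_eq_mul_inv] using this)
    (fun x hx y hy h => by
      have hx' : x ≠ 0 := ne_of_gt hx
      have hy' : y ≠ 0 := ne_of_gt hy
      have h : s / x = s / y := h
      rw [div_eq_div_iff hx' hy'] at h
      exact (mul_left_cancel₀ hs.ne' h).symm) G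
  rw [himg] at this
  rw [this]
  refine setLIntegral_congr_fun measurableSet_Ioi fun b _ => ?_
  simp only [abs_neg]
  rw [abs_of_nonneg (by positivity)]

section Orbit

variable {n : ℕ}

/-- A sample and its standardization have the same orbit. The shift in `a` costs nothing, and
rescaling `b` by the deviation `s` yields `s * s ^ (n - 2)`. -/
theorem lintegral_standardize_orbit (hn : 2 ≤ n) {x : Fin n → ℝ} (hx : sampleSD x ≠ 0)
    (P : (Fin n → ℝ) → ℝ≥0∞) :
    ∫⁻ b in Ioi (0 : ℝ), ∫⁻ a : ℝ,
        ENNReal.ofReal (b ^ (n - 2)) * P (fun i => a + b * standardize x i) =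
      ENNReal.ofReal (sampleSD x ^ (n - 1)) * ∫⁻ b in Ioi (0 : ℝ), ∫⁻ a : ℝ,
        ENNReal.ofReal (b ^ (n - 2)) * P (fun i => a + b * x i) := by
  have hs : 0 < sampleSD x := lt_of_le_of_ne (sampleSD_nonneg x) hx.symm
  rw [lintegral_Ioi_eq_lintegral_mul hs, ← lintegral_const_mul' _ _ ENNReal.ofReal_ne_top,
    ← lintegral_const_mul' _ _ ENNReal.ofReal_ne_top]
  refine setLIntegral_congr_fun measurableSet_Ioi fun b hb => ?_
  have hb : 0 < b := hb
  rw [lintegral_const_mul' _ _ ENNReal.ofReal_ne_top, lintegral_const_mul' _ _ ENNReal.ofReal_ne_top,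
    ← mul_assoc, ← mul_assoc, ← ENNReal.ofReal_mul hs.le, ← ENNReal.ofReal_mul (by positivity)]
  congr 1
  · congr 1
    obtain ⟨m, rfl⟩ := Nat.exists_eq_add_of_le hn
    rw [show 2 + m - 2 = m by omega, show 2 + m - 1 = m + 1 by omega]
    ring
  · simp_rw [affine_eq_affine_standardize hx]
    rw [lintegral_add_right_eq_self
      (fun a => P fun i => a + b * sampleSD x * standardize x i) (b * sampleMean x)]
    simp_rw [mul_comm b]

theorem prod_ofReal_gaussianPDFReal (y : Fin n → ℝ) :
    ∏ i, ENNReal.ofReal (gaussianPDFReal 0 1 (y i)) =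
      ENNReal.ofReal ((Real.sqrt (2 * Real.pi))⁻¹ ^ n * Real.exp (-(∑ i, y i ^ 2) / 2)) := by
  rw [← ENNReal.ofReal_prod_of_nonneg fun i _ => gaussianPDFReal_nonneg 0 1 (y i)]
  congr 1
  simp only [gaussianPDFReal, NNReal.coe_one, mul_one, sub_zero, Finset.prod_mul_distrib,
    Finset.prod_const, Finset.card_fin]
  rw [← Real.exp_sum, neg_div, Finset.sum_div, ← Finset.sum_neg_distrib]
  simp_rw [neg_div]

theorem prod_ofReal_gaussianPDFReal_affine_standardize {x : Fin n → ℝ} (hx : sampleSD x ≠ 0)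
    (a b : ℝ) :
    ∏ i, ENNReal.ofReal (gaussianPDFReal 0 1 (a + b * standardize x i)) =
      ENNReal.ofReal ((Real.sqrt (2 * Real.pi))⁻¹ ^ n) *
        ENNReal.ofReal (Real.exp (-(n * (a ^ 2 + b ^ 2) / 2))) := by
  rw [prod_ofReal_gaussianPDFReal fun i => a + b * standardize x i,
    sum_affine_standardize_sq hx, ENNReal.ofReal_mul (by positivity), neg_div]

/-- The substitutions `b ↦ s / b` and `a ↦ ȳ - b a`, with `s` the deviation of `y`, carry the orbit
under inverse maps to that of the standardized sample, where the normal density is explicit. The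
point is that the right side no longer depends on `y`. -/
theorem lintegral_inverse_orbit (hn : 2 ≤ n) {y : Fin n → ℝ} (hy : sampleSD y ≠ 0) :
    ENNReal.ofReal (sampleSD y ^ (n - 1)) * ∫⁻ b in Ioi (0 : ℝ), ∫⁻ a : ℝ,
        ENNReal.ofReal (b⁻¹ ^ (n + 1)) *
          ∏ i, ENNReal.ofReal (gaussianPDFReal 0 1 (-(a / b) + b⁻¹ * y i)) =
      ENNReal.ofReal ((Real.sqrt (2 * Real.pi))⁻¹ ^ n) *
        ∫⁻ b in Ioi (0 : ℝ), ∫⁻ a : ℝ, ENNReal.ofReal (weight n a b) := by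
  have hs : 0 < sampleSD y := lt_of_le_of_ne (sampleSD_nonneg y) hy.symm
  rw [lintegral_Ioi_eq_lintegral_div hs (fun b => ∫⁻ a : ℝ, ENNReal.ofReal (weight n a b)),
    ← lintegral_const_mul' _ _ ENNReal.ofReal_ne_top,
    ← lintegral_const_mul' _ _ ENNReal.ofReal_ne_top]
  refine setLIntegral_congr_fun measurableSet_Ioi fun b hb => ?_
  have hb : 0 < b := hb
  rw [lintegral_eq_lintegral_affine (neg_ne_zero.2 hb.ne') (sampleMean y), abs_neg, abs_of_pos hb]
  have h : ∀ a i, -((sampleMean y + -b * a) / b) + b⁻¹ * y i =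
      a + (sampleSD y / b) * standardize y i := by
    intro a i
    simp only [standardize]
    field_simp
    ring
  simp_rw [h, prod_ofReal_gaussianPDFReal_affine_standardize hy, weight]
  simp_rw [ENNReal.ofReal_mul (Real.exp_nonneg _)]
  rw [lintegral_const_mul' _ _ ENNReal.ofReal_ne_top, lintegral_const_mul' _ _ ENNReal.ofReal_ne_top,
    lintegral_mul_const' _ _ ENNReal.ofReal_ne_top]
  have hk : ENNReal.ofReal (sampleSD y ^ (n - 1)) * (ENNReal.ofReal b *
      ENNReal.ofReal (b⁻¹ ^ (n + 1))) =
      ENNReal.ofReal (sampleSD y / b ^ 2) * ENNReal.ofReal ((sampleSD y / b) ^ (n - 2)) := by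
    rw [← ENNReal.ofReal_mul (by positivity), ← ENNReal.ofReal_mul (by positivity),
      ← ENNReal.ofReal_mul (by positivity)]
    congr 1
    obtain ⟨m, rfl⟩ := Nat.exists_eq_add_of_le hn
    rw [show 2 + m - 2 = m by omega, show 2 + m - 1 = m + 1 by omega]
    have hu : b * b⁻¹ = 1 := mul_inv_cancel₀ hb.ne'
    simp only [div_eq_mul_inv, ← inv_pow]
    generalize b⁻¹ = u at hu
    linear_combination sampleSD y ^ (m + 1) * u ^ (m + 2) * hu
  set I := ∫⁻ a : ℝ, ENNReal.ofReal (Real.exp (-(n * (a ^ 2 + (sampleSD y / b) ^ 2) / 2)))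
  calc _ = ENNReal.ofReal (sampleSD y ^ (n - 1)) * (ENNReal.ofReal b *
      ENNReal.ofReal (b⁻¹ ^ (n + 1))) *
        (ENNReal.ofReal ((Real.sqrt (2 * Real.pi))⁻¹ ^ n) * I) := by ring
    _ = _ := by rw [hk]; ring

end Orbit

/-! ### The orbit measure and Wijsman's representation. -/

noncomputable section

/-- The finite measure `weight n a b da db` on the parameters `(a, b)`, `b > 0`. -/
def orbitMeasure (n : ℕ) : Measure (ℝ × ℝ) :=
  (volume.prod (volume.restrict (Ioi 0))).withDensity fun p => ENNReal.ofReal (weight n p.1 p.2)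

/-- The likelihood ratio of `θ` against `0` at the sample `a + b z`, where `p = (a, b)`. -/
def orbitRatio (f : ℝ → ℝ → ℝ) {n : ℕ} (θ : ℝ) (z : Fin n → ℝ) (p : ℝ × ℝ) : ℝ :=
  ∏ i, (f (p.1 + p.2 * z i) θ / f (p.1 + p.2 * z i) 0)

end

theorem measurable_weight (n : ℕ) : Measurable fun p : ℝ × ℝ => weight n p.1 p.2 := by
  unfold weight; fun_prop

theorem weight_nonneg (n : ℕ) (a : ℝ) {b : ℝ} (hb : 0 ≤ b) : 0 ≤ weight n a b := by
  unfold weight; positivity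

theorem weight_pos (n : ℕ) (a : ℝ) {b : ℝ} (hb : 0 < b) : 0 < weight n a b := by
  unfold weight; positivity

theorem ae_snd_pos : ∀ᵐ p : ℝ × ℝ ∂(volume.prod (volume.restrict (Ioi 0))), 0 < p.2 :=
  Measure.quasiMeasurePreserving_snd.ae (ae_restrict_mem measurableSet_Ioi)

theorem integrable_weight {n : ℕ} (hn : 2 ≤ n) :
    Integrable (fun p : ℝ × ℝ => weight n p.1 p.2) (volume.prod (volume.restrict (Ioi 0))) := by
  have hn0 : (0 : ℝ) < n / 2 := by positivity
  have h1 : Integrable fun a : ℝ => Real.exp (-(n / 2 : ℝ) * a ^ 2) := integrable_exp_neg_mul_sq hn0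
  have h2 : IntegrableOn (fun b : ℝ => b ^ ((n - 2 : ℕ) : ℝ) * Real.exp (-(n / 2 : ℝ) * b ^ 2))
      (Ioi 0) := integrableOn_rpow_mul_exp_neg_mul_sq hn0 (by
        have : (0 : ℝ) ≤ ((n - 2 : ℕ) : ℝ) := Nat.cast_nonneg _
        linarith)
  refine (h1.mul_prod h2).congr (Filter.Eventually.of_forall fun p => ?_)
  simp only [weight, Real.rpow_natCast]
  rw [mul_left_comm, ← Real.exp_add, mul_comm]
  ring_nf

theorem lintegral_orbitMeasure (n : ℕ) {G : ℝ × ℝ → ℝ≥0∞} (hG : Measurable G) :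
    ∫⁻ p, G p ∂orbitMeasure n =
      ∫⁻ b in Ioi (0 : ℝ), ∫⁻ a : ℝ, ENNReal.ofReal (weight n a b) * G (a, b) := by
  have hw := (measurable_weight n).ennreal_ofReal
  rw [orbitMeasure, lintegral_withDensity_eq_lintegral_mul _ hw hG,
    lintegral_prod_symm' _ (hw.mul hG)]
  rfl

instance isFiniteMeasure_orbitMeasure (n : ℕ) [Fact (2 ≤ n)] : IsFiniteMeasure (orbitMeasure n) :=
  isFiniteMeasure_withDensity_ofReal (integrable_weight Fact.out).2

theorem orbitMeasure_univ_ne_zero (n : ℕ) : orbitMeasure n univ ≠ 0 := by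
  rw [orbitMeasure, withDensity_apply _ MeasurableSet.univ, Measure.restrict_univ]
  intro h
  rw [lintegral_eq_zero_iff (measurable_weight n).ennreal_ofReal] at h
  have hfalse : ∀ᵐ p : ℝ × ℝ ∂(volume.prod (volume.restrict (Ioi 0))), False := by
    filter_upwards [h, ae_snd_pos] with p hp hpos
    have := weight_pos n p.1 hpos
    simp only [Pi.zero_apply, ENNReal.ofReal_eq_zero] at hp
    linarith
  rw [Filter.eventually_false_iff_eq_bot, ae_eq_bot, ← Measure.measure_univ_eq_zero,
    ← univ_prod_univ, Measure.prod_prod] at hfalse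
  simp at hfalse

theorem lintegral_lintegral_lintegral_comm {α : Type*} [MeasurableSpace α] {μ : Measure α}
    [SFinite μ] {ν ρ : Measure ℝ} [SFinite ν] [SFinite ρ] {H : α → ℝ → ℝ → ℝ≥0∞}
    (hH : Measurable fun q : α × ℝ × ℝ => H q.1 q.2.1 q.2.2) :
    ∫⁻ x, ∫⁻ b, ∫⁻ a, H x b a ∂ρ ∂ν ∂μ = ∫⁻ b, ∫⁻ a, ∫⁻ x, H x b a ∂μ ∂ρ ∂ν := by
  rw [lintegral_lintegral_swap]
  · refine lintegral_congr fun b => lintegral_lintegral_swap ?_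
    exact (hH.comp (g := fun q : α × ℝ × ℝ => H q.1 q.2.1 q.2.2)
      (f := fun q : α × ℝ => (q.1, b, q.2)) (by fun_prop)).aemeasurable
  · refine Measurable.aemeasurable ?_
    have : Measurable fun q : (α × ℝ) × ℝ => H q.1.1 q.1.2 q.2 :=
      hH.comp (g := fun q : α × ℝ × ℝ => H q.1 q.2.1 q.2.2)
        (f := fun q : (α × ℝ) × ℝ => (q.1.1, q.1.2, q.2)) (by fun_prop)
    exact this.lintegral_prod_right'

section

variable {f : ℝ → ℝ → ℝ} {n : ℕ} {θ : ℝ}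

theorem measurable_orbitRatio {β : Type*} [MeasurableSpace β] (hm : Measurable fun x => f x θ)
    (hm0 : Measurable fun x => f x 0) {z : β → Fin n → ℝ} (hz : Measurable z) {p : β → ℝ × ℝ}
    (hp : Measurable p) : Measurable fun x => orbitRatio f θ (z x) (p x) := by
  unfold orbitRatio
  refine Finset.measurable_prod _ fun i _ => ?_
  have h : Measurable fun x => (p x).1 + (p x).2 * z x i := by fun_prop
  exact (hm.comp h).div (hm0.comp h)

/-- The exponential in `weight` is, up to the constant on the left, the null density along the
orbit, so it cancels the denominators of the ratio. -/
theorem mul_lintegral_orbitRatio (hm : Measurable fun x => f x θ) (h0 : ∀ x, 0 < f x θ)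
    (hf_zero : ∀ x, f x 0 = gaussianPDFReal 0 1 x) {x : Fin n → ℝ} (hx : sampleSD x ≠ 0) :
    ENNReal.ofReal ((Real.sqrt (2 * Real.pi))⁻¹ ^ n) *
        ∫⁻ p, ENNReal.ofReal (orbitRatio f θ (standardize x) p) ∂orbitMeasure n =
      ∫⁻ b in Ioi (0 : ℝ), ∫⁻ a : ℝ, ENNReal.ofReal (b ^ (n - 2)) *
        ∏ i, ENNReal.ofReal (f (a + b * standardize x i) θ) := by
  have hm0 : Measurable fun x => f x 0 := by
    simp_rw [hf_zero]; exact measurable_gaussianPDFReal 0 1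
  rw [lintegral_orbitMeasure n
    (measurable_orbitRatio hm hm0 (p := fun p => p) measurable_const
      measurable_id).ennreal_ofReal,
    ← lintegral_const_mul' _ _ ENNReal.ofReal_ne_top]
  refine setLIntegral_congr_fun measurableSet_Ioi fun b hb => ?_
  have hb : 0 < b := hb
  rw [← lintegral_const_mul' _ _ ENNReal.ofReal_ne_top]
  refine lintegral_congr fun a => ?_
  have hg := prod_ofReal_gaussianPDFReal_affine_standardize hx a b
  rw [weight, ENNReal.ofReal_mul (Real.exp_nonneg _)]
  calc _ = ENNReal.ofReal (b ^ (n - 2)) * ((ENNReal.ofReal ((Real.sqrt (2 * Real.pi))⁻¹ ^ n) *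
        ENNReal.ofReal (Real.exp (-(n * (a ^ 2 + b ^ 2) / 2)))) *
          ENNReal.ofReal (orbitRatio f θ (standardize x) (a, b))) := by ring
    _ = _ := by
      rw [← hg]
      congr 1
      have hpos : ∀ y, 0 < f y 0 := fun y => hf_zero y ▸ gaussianPDFReal_pos 0 1 y one_ne_zero
      rw [orbitRatio, ENNReal.ofReal_prod_of_nonneg fun i _ =>
        (div_pos (h0 _) (hpos _)).le, ← Finset.prod_mul_distrib]
      refine Finset.prod_congr rfl fun i _ => ?_
      rw [← hf_zero, ← ENNReal.ofReal_mul (hpos _).le, mul_div_cancel₀ _ (hpos _).ne']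

/-- Write the right side as a triple integral over `x`, `b`, `a`, and for fixed `(a, b)` take `y = a
+ b x` as the new sample. The density at `θ` then sits at `y` and the normal density at the inverse
image, whose orbit integral is constant by `lintegral_inverse_orbit`. All integrands are
nonnegative, so Tonelli applies without integrability. -/
theorem lintegral_mul_likelihood_eq (hn : 2 ≤ n) (hm : Measurable fun x => f x θ)
    (h0 : ∀ x, 0 < f x θ) (hf_zero : ∀ x, f x 0 = gaussianPDFReal 0 1 x)
    {F : (Fin n → ℝ) → ℝ≥0∞}
    (hF : Measurable F) (hinv : ∀ a b : ℝ, 0 < b → ∀ x, F (fun i => a + b * x i) = F x) :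
    (∫⁻ x, F x * ∏ i, ENNReal.ofReal (f (x i) θ)) * orbitMeasure n univ =
      ∫⁻ x, F x * (∏ i, ENNReal.ofReal (f (x i) 0)) *
        ∫⁻ p, ENNReal.ofReal (orbitRatio f θ (standardize x) p) ∂orbitMeasure n := by
  set c := ENNReal.ofReal ((Real.sqrt (2 * Real.pi))⁻¹ ^ n) with hc
  have hc0 : c ≠ 0 := by
    rw [hc, ne_eq, ENNReal.ofReal_eq_zero, not_le]
    positivity
  have hP : ∀ {β : Type} [MeasurableSpace β] {g : β → Fin n → ℝ}, Measurable g →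
      Measurable fun q => ∏ i, ENNReal.ofReal (f (g q i) θ) := fun {β} _ {g} hg =>
    Finset.measurable_prod _ fun i _ =>
      (hm.comp (g := fun x => f x θ) (f := fun q => g q i) (by fun_prop)).ennreal_ofReal
  have hG : ∀ {β : Type} [MeasurableSpace β] {g : β → Fin n → ℝ}, Measurable g →
      Measurable fun q => ∏ i, ENNReal.ofReal (gaussianPDFReal 0 1 (g q i)) := fun {β} _ {g} hg =>
    Finset.measurable_prod _ fun i _ =>
      ((measurable_gaussianPDFReal 0 1).comp (f := fun q => g q i) (by fun_prop)).ennreal_ofReal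
  have hS := measurable_sampleSD (n := n)
  have hn0 : n ≠ 0 := by omega
  simp_rw [hf_zero]
  refine (ENNReal.mul_right_inj hc0 ENNReal.ofReal_ne_top).1 ?_
  symm
  calc c * ∫⁻ x : Fin n → ℝ, F x * (∏ i, ENNReal.ofReal (gaussianPDFReal 0 1 (x i))) *
        ∫⁻ p, ENNReal.ofReal (orbitRatio f θ (standardize x) p) ∂orbitMeasure n
      = ∫⁻ x : Fin n → ℝ, ∫⁻ b in Ioi (0 : ℝ), ∫⁻ a : ℝ,
          F x * (∏ i, ENNReal.ofReal (gaussianPDFReal 0 1 (x i))) *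
            ENNReal.ofReal (sampleSD x ^ (n - 1)) * (ENNReal.ofReal (b ^ (n - 2)) *
              ∏ i, ENNReal.ofReal (f (a + b * x i) θ)) := by
        rw [← lintegral_const_mul' _ _ ENNReal.ofReal_ne_top]
        refine lintegral_congr_ae ?_
        filter_upwards [ae_sampleSD_ne_zero hn] with x hx
        rw [mul_left_comm, mul_lintegral_orbitRatio hm h0 hf_zero hx,
          lintegral_standardize_orbit hn hx fun y => ∏ i, ENNReal.ofReal (f (y i) θ), ← mul_assoc]
        rw [← lintegral_const_mul]
        · refine lintegral_congr fun b => ?_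
          rw [← lintegral_const_mul]
          exact measurable_const.mul (hP (g := fun a i => a + b * x i) (by fun_prop))
        · refine Measurable.lintegral_prod_right' (f := fun q : ℝ × ℝ =>
            ENNReal.ofReal (q.1 ^ (n - 2)) * ∏ i, ENNReal.ofReal (f (q.2 + q.1 * x i) θ)) ?_
          exact Measurable.mul (by fun_prop)
            (hP (g := fun (q : ℝ × ℝ) i => q.2 + q.1 * x i) (by fun_prop))
    _ = ∫⁻ b in Ioi (0 : ℝ), ∫⁻ a : ℝ, ∫⁻ x : Fin n → ℝ,
          F x * (∏ i, ENNReal.ofReal (gaussianPDFReal 0 1 (x i))) *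
            ENNReal.ofReal (sampleSD x ^ (n - 1)) * (ENNReal.ofReal (b ^ (n - 2)) *
              ∏ i, ENNReal.ofReal (f (a + b * x i) θ)) := by
        refine lintegral_lintegral_lintegral_comm ?_
        have h1 := hG (g := fun q : (Fin n → ℝ) × ℝ × ℝ => q.1) (by fun_prop)
        have h2 := hP (g := fun (q : (Fin n → ℝ) × ℝ × ℝ) i => q.2.2 + q.2.1 * q.1 i)
          (by fun_prop)
        fun_prop
    _ = ∫⁻ b in Ioi (0 : ℝ), ∫⁻ a : ℝ, ∫⁻ y : Fin n → ℝ,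
          F y * (∏ i, ENNReal.ofReal (f (y i) θ)) * ENNReal.ofReal (sampleSD y ^ (n - 1)) *
            (ENNReal.ofReal (b⁻¹ ^ (n + 1)) *
              ∏ i, ENNReal.ofReal (gaussianPDFReal 0 1 (-(a / b) + b⁻¹ * y i))) := by
        refine setLIntegral_congr_fun measurableSet_Ioi fun b hb => lintegral_congr fun a => ?_
        have hb : 0 < b := hb
        rw [lintegral_pi_eq_lintegral_affine (-(a / b)) (inv_pos.2 hb),
          ← lintegral_const_mul' _ _ ENNReal.ofReal_ne_top]
        · refine lintegral_congr fun y => ?_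
          have h : ∀ i, a + b * (-(a / b) + b⁻¹ * y i) = y i := fun i => by field_simp; ring
          simp_rw [h, hinv _ _ (inv_pos.2 hb), sampleSD_affine hn0 _ (inv_pos.2 hb)]
          rw [mul_pow, ENNReal.ofReal_mul (by positivity)]
          -- The three powers come from the Jacobian, from the deviation of the rescaled sample, and
          -- from the orbit weight.
          have hk : ENNReal.ofReal (b⁻¹ ^ n) * (ENNReal.ofReal (b⁻¹ ^ (n - 1)) *
              ENNReal.ofReal (b ^ (n - 2))) = ENNReal.ofReal (b⁻¹ ^ (n + 1)) := by
            rw [← ENNReal.ofReal_mul (by positivity), ← ENNReal.ofReal_mul (by positivity)]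
            congr 1
            obtain ⟨m, rfl⟩ := Nat.exists_eq_add_of_le hn
            rw [show 2 + m - 2 = m by omega, show 2 + m - 1 = m + 1 by omega]
            have hu : b⁻¹ * b = 1 := inv_mul_cancel₀ hb.ne'
            calc b⁻¹ ^ (2 + m) * (b⁻¹ ^ (m + 1) * b ^ m)
                = b⁻¹ ^ (2 + m + 1) * (b⁻¹ * b) ^ m := by rw [mul_pow]; ring
              _ = _ := by rw [hu, one_pow, mul_one]
          rw [← hk]
          ring
        · have h1 := hG (g := fun q : Fin n → ℝ => q) (by fun_prop)
          have h2 := hP (g := fun (q : Fin n → ℝ) i => a + b * q i) (by fun_prop)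
          fun_prop
    _ = ∫⁻ y : Fin n → ℝ, ∫⁻ b in Ioi (0 : ℝ), ∫⁻ a : ℝ,
          F y * (∏ i, ENNReal.ofReal (f (y i) θ)) * ENNReal.ofReal (sampleSD y ^ (n - 1)) *
            (ENNReal.ofReal (b⁻¹ ^ (n + 1)) *
              ∏ i, ENNReal.ofReal (gaussianPDFReal 0 1 (-(a / b) + b⁻¹ * y i))) := by
        symm
        refine lintegral_lintegral_lintegral_comm ?_
        have h1 := hP (g := fun q : (Fin n → ℝ) × ℝ × ℝ => q.1) (by fun_prop)
        have h2 := hG (g := fun (q : (Fin n → ℝ) × ℝ × ℝ) i => -(q.2.2 / q.2.1) + q.2.1⁻¹ * q.1 i)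
          (by fun_prop)
        fun_prop
    _ = ∫⁻ y : Fin n → ℝ, F y * (∏ i, ENNReal.ofReal (f (y i) θ)) *
          (c * orbitMeasure n univ) := by
        refine lintegral_congr_ae ?_
        filter_upwards [ae_sampleSD_ne_zero hn] with y hy
        have h1 : orbitMeasure n univ =
            ∫⁻ b in Ioi (0 : ℝ), ∫⁻ a : ℝ, ENNReal.ofReal (weight n a b) := by
          rw [← lintegral_one, lintegral_orbitMeasure n measurable_const]
          simp
        have hmeas : Measurable fun q : ℝ × ℝ =>
            ∏ i, ENNReal.ofReal (gaussianPDFReal 0 1 (-(q.2 / q.1) + q.1⁻¹ * y i)) :=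
          hG (g := fun (q : ℝ × ℝ) i => -(q.2 / q.1) + q.1⁻¹ * y i) (by fun_prop)
        rw [h1, ← lintegral_inverse_orbit hn hy, ← mul_assoc, ← lintegral_const_mul]
        · refine lintegral_congr fun b => ?_
          rw [← lintegral_const_mul]
          exact measurable_const.mul
            (hG (g := fun a i => -(a / b) + b⁻¹ * y i) (by fun_prop))
        · refine Measurable.lintegral_prod_right' (f := fun q : ℝ × ℝ =>
            ENNReal.ofReal (q.1⁻¹ ^ (n + 1)) *
              ∏ i, ENNReal.ofReal (gaussianPDFReal 0 1 (-(q.2 / q.1) + q.1⁻¹ * y i))) ?_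
          exact Measurable.mul (by fun_prop) hmeas
    _ = c * ((∫⁻ y : Fin n → ℝ, F y * ∏ i, ENNReal.ofReal (f (y i) θ)) *
          orbitMeasure n univ) := by
        have hFP : Measurable fun y : Fin n → ℝ => F y * ∏ i, ENNReal.ofReal (f (y i) θ) :=
          hF.mul (hP (g := fun y => y) measurable_id)
        rw [lintegral_mul_const _ hFP]
        ring

end

/-! ### Derivatives in `θ` and elementary bounds on likelihood ratios. -/

section Score

variable {f : ℝ → ℝ → ℝ} {n : ℕ}

theorem hasDerivWithinAt_log_score
    (hf_smooth : ∀ x, ContDiffOn ℝ 1 (fun θ => Real.log (f x θ)) (Ici 0)) (y : ℝ) {θ : ℝ}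
    (hθ : 0 ≤ θ) : HasDerivWithinAt (fun t => Real.log (f y t)) (score f y θ) (Ici 0) θ :=
  (((hf_smooth y).differentiableOn one_ne_zero) θ hθ).hasDerivWithinAt

theorem hasDerivWithinAt_density (hf_pos : ∀ θ : ℝ, 0 ≤ θ → ∀ x, 0 < f x θ)
    (hf_smooth : ∀ x, ContDiffOn ℝ 1 (fun θ => Real.log (f x θ)) (Ici 0)) (y : ℝ) {θ : ℝ}
    (hθ : 0 ≤ θ) : HasDerivWithinAt (fun t => f y t) (f y θ * score f y θ) (Ici 0) θ := by
  have h := (hasDerivWithinAt_log_score hf_smooth y hθ).exp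
  rw [Real.exp_log (hf_pos θ hθ y)] at h
  exact h.congr (fun t ht => (Real.exp_log (hf_pos t ht y)).symm)
    (Real.exp_log (hf_pos θ hθ y)).symm

theorem densityDeriv_eq_mul_score (hf_pos : ∀ θ : ℝ, 0 ≤ θ → ∀ x, 0 < f x θ)
    (hf_smooth : ∀ x, ContDiffOn ℝ 1 (fun θ => Real.log (f x θ)) (Ici 0)) (y : ℝ) {θ : ℝ}
    (hθ : 0 ≤ θ) : densityDeriv f y θ = f y θ * score f y θ :=
  (hasDerivWithinAt_density hf_pos hf_smooth y hθ).derivWithin (uniqueDiffOn_Ici 0 θ hθ)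

theorem abs_ratio_sub_one_le (hf_pos : ∀ θ : ℝ, 0 ≤ θ → ∀ x, 0 < f x θ)
    (hf_smooth : ∀ x, ContDiffOn ℝ 1 (fun θ => Real.log (f x θ)) (Ici 0)) {y ε G : ℝ}
    (hG : ∀ t ∈ Icc 0 ε, |densityDeriv f y t| / f y 0 ≤ G) {θ : ℝ} (hθ : θ ∈ Icc 0 ε) :
    |f y θ / f y 0 - 1| ≤ θ * G := by
  have h0 := hf_pos 0 le_rfl y
  have hb := Convex.norm_image_sub_le_of_norm_hasDerivWithin_le (f := fun t => f y t)
    (f' := fun t => f y t * score f y t) (C := G * f y 0) (s := Icc 0 ε) (x := 0) (y := θ)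
    (fun t ht => (hasDerivWithinAt_density hf_pos hf_smooth y ht.1).mono Icc_subset_Ici_self)
    (fun t ht => by
      rw [← densityDeriv_eq_mul_score hf_pos hf_smooth y ht.1, Real.norm_eq_abs]
      exact (div_le_iff₀ h0).1 (hG t ht)) (convex_Icc 0 ε) ⟨le_rfl, hθ.1.trans hθ.2⟩ hθ
  rw [sub_zero, Real.norm_eq_abs, Real.norm_eq_abs, abs_of_nonneg hθ.1] at hb
  rw [div_sub_one h0.ne', abs_div, abs_of_pos h0, div_le_iff₀ h0]
  linarith

/-- Induction on the factors through `r P - 1 = (r - 1) P + (P - 1)`. -/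
theorem abs_prod_sub_one_le {ι : Type*} (s : Finset ι) {r : ι → ℝ} {t : ℝ} (ht : 0 ≤ t)
    (h : ∀ i ∈ s, |r i - 1| ≤ t) : |∏ i ∈ s, r i - 1| ≤ (1 + t) ^ s.card - 1 := by
  classical
  induction s using Finset.induction_on with
  | empty => simp
  | insert i s hi ih =>
    have ih := ih fun j hj => h j (Finset.mem_insert_of_mem hj)
    have hi' := h i (Finset.mem_insert_self i s)
    rw [Finset.prod_insert hi, Finset.card_insert_of_notMem hi]
    set P := ∏ j ∈ s, r j
    have hP : |P| ≤ (1 + t) ^ s.card := by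
      calc |P| = |(P - 1) + 1| := by ring_nf
        _ ≤ |P - 1| + |(1 : ℝ)| := abs_add_le _ _
        _ ≤ _ := by rw [abs_one]; linarith
    calc |r i * P - 1| = |(r i - 1) * P + (P - 1)| := by ring_nf
      _ ≤ |r i - 1| * |P| + |P - 1| := (abs_add_le _ _).trans_eq (by rw [abs_mul])
      _ ≤ t * (1 + t) ^ s.card + ((1 + t) ^ s.card - 1) := by gcongr
      _ = _ := by ring

/-- Convexity of the `n`-th power between `1` and `1 + G`. It extracts the factor `θ`, so that
difference quotients get a bound free of `θ`. -/
theorem one_add_mul_pow_sub_one_le {θ G : ℝ} (hθ : θ ∈ Icc (0 : ℝ) 1) (hG : 0 ≤ G) (n : ℕ) :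
    (1 + θ * G) ^ n - 1 ≤ θ * (1 + G) ^ n := by
  have hmem : 1 + G ∈ Ici (0 : ℝ) := by simp only [mem_Ici]; linarith
  have h := (convexOn_pow n).2 (mem_Ici.2 zero_le_one) hmem (sub_nonneg.2 hθ.2) hθ.1
    (sub_add_cancel 1 θ)
  simp only [smul_eq_mul, mul_one, one_pow] at h
  rw [show 1 - θ + θ * (1 + G) = 1 + θ * G by ring] at h
  linarith [hθ.1]

/-- The score is a pointwise limit of the difference quotients at `θ = 1 / (m + 1)`. -/
theorem measurable_score (hf_meas : ∀ θ : ℝ, 0 ≤ θ → Measurable fun x => f x θ)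
    (hf_smooth : ∀ x, ContDiffOn ℝ 1 (fun θ => Real.log (f x θ)) (Ici 0)) :
    Measurable fun y => score f y 0 := by
  have hlim : Tendsto (fun m : ℕ => 1 / ((m : ℝ) + 1)) atTop (𝓝[>] 0) :=
    tendsto_nhdsWithin_iff.2 ⟨tendsto_one_div_add_atTop_nhds_zero_nat,
      Eventually.of_forall fun m => by simp only [mem_Ioi]; positivity⟩
  refine measurable_of_tendsto_metrizable
    (f := fun (m : ℕ) y => slope (fun t => Real.log (f y t)) 0 (1 / ((m : ℝ) + 1)))
    (fun m => ?_) (tendsto_pi_nhds.2 fun y => ?_)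
  · simp only [slope_def_field]
    exact ((hf_meas _ (by positivity)).log.sub (hf_meas 0 le_rfl).log).div_const _
  · have h := (hasDerivWithinAt_log_score hf_smooth y le_rfl).mono (Ioi_subset_Ici_self (a := 0))
    rw [hasDerivWithinAt_iff_tendsto_slope' (by simp)] at h
    exact h.comp hlim

theorem orbitRatio_zero (hf_pos : ∀ θ : ℝ, 0 ≤ θ → ∀ x, 0 < f x θ) (z : Fin n → ℝ) (p : ℝ × ℝ) :
    orbitRatio f 0 z p = 1 :=
  Finset.prod_eq_one fun _ _ => div_self (hf_pos 0 le_rfl _).ne'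

theorem hasDerivWithinAt_orbitRatio (hf_pos : ∀ θ : ℝ, 0 ≤ θ → ∀ x, 0 < f x θ)
    (hf_smooth : ∀ x, ContDiffOn ℝ 1 (fun θ => Real.log (f x θ)) (Ici 0)) (z : Fin n → ℝ)
    (p : ℝ × ℝ) : HasDerivWithinAt (fun θ => orbitRatio f θ z p)
      (∑ i, score f (p.1 + p.2 * z i) 0) (Ici 0) 0 := by
  have h := HasDerivWithinAt.fun_finsetProd (u := (Finset.univ : Finset (Fin n)))
    (f := fun i θ => f (p.1 + p.2 * z i) θ / f (p.1 + p.2 * z i) 0) (x := 0) (s := Ici 0)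
    (fun i _ => (hasDerivWithinAt_density hf_pos hf_smooth (p.1 + p.2 * z i) le_rfl).div_const _)
  refine h.congr_deriv (Finset.sum_congr rfl fun i _ => ?_)
  rw [Finset.prod_eq_one fun j _ => div_self (hf_pos 0 le_rfl _).ne', one_smul,
    mul_div_cancel_left₀ _ (hf_pos 0 le_rfl _).ne']

end Score

/-! ### A measurable envelope for the score. -/

noncomputable section

/-- The supremum over `0 ≤ θ ≤ ε` of `|∂f/∂θ (y;θ)| / f(y;0)`. -/
def scoreEnvelope (f : ℝ → ℝ → ℝ) (ε y : ℝ) : ℝ≥0∞ :=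
  ⨆ (θ : ℝ) (_ : θ ∈ Icc 0 ε), ENNReal.ofReal (|densityDeriv f y θ| / f y 0)

/-- The supremum of `scoreEnvelope` over the points `y = a + b z` with `|z| < √n`. In contrast to
`scoreSup` it is lower semicontinuous, hence measurable. -/
def scoreOpenSup (f : ℝ → ℝ → ℝ) (n : ℕ) (ε : ℝ) (p : ℝ × ℝ) : ℝ≥0∞ :=
  ⨆ y : ℝ, {p : ℝ × ℝ | |y - p.1| < p.2 * Real.sqrt n}.indicator (fun _ => scoreEnvelope f ε y) p

end

section Envelope

variable {f : ℝ → ℝ → ℝ} {n : ℕ} {ε : ℝ}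

/-- For each `y` the condition on `p` is open, so this is a supremum of lower semicontinuous
functions. No regularity of `f` in `x` is needed, although the supremum is uncountable. -/
theorem measurable_scoreOpenSup : Measurable (scoreOpenSup f n ε) := by
  refine LowerSemicontinuous.measurable (lowerSemicontinuous_iSup fun y => ?_)
  exact (isOpen_lt (by fun_prop) (by fun_prop)).lowerSemicontinuous_indicator zero_le

theorem scoreOpenSup_le_scoreSup (a : ℝ) {b : ℝ} (hb : 0 < b) :
    scoreOpenSup f n ε (a, b) ≤ scoreSup f n ε a b := by
  refine iSup_le fun y => ?_
  by_cases hy : |y - a| < b * Real.sqrt n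
  · rw [indicator_of_mem (show (a, b) ∈ {p : ℝ × ℝ | |y - p.1| < p.2 * Real.sqrt n} from hy)]
    have hz : |(y - a) / b| ≤ Real.sqrt n := by
      rw [abs_div, abs_of_pos hb, div_le_iff₀ hb, mul_comm]
      exact hy.le
    have hyz : a + b * ((y - a) / b) = y := by field_simp; ring
    refine le_iSup₂_of_le ((y - a) / b) hz ?_
    rw [hyz, scoreEnvelope]
  · rw [indicator_of_notMem (show (a, b) ∉ {p : ℝ × ℝ | |y - p.1| < p.2 * Real.sqrt n} from hy)]
    exact zero_le

theorem scoreEnvelope_le_scoreOpenSup (a : ℝ) {b z : ℝ} (hb : 0 < b) (hz : |z| < Real.sqrt n) :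
    scoreEnvelope f ε (a + b * z) ≤ scoreOpenSup f n ε (a, b) := by
  refine le_iSup_of_le (a + b * z) ?_
  rw [indicator_of_mem]
  simp only [mem_ofPred_eq, add_sub_cancel_left, abs_mul, abs_of_pos hb]
  gcongr

theorem lintegral_scoreOpenSup_pow_lt_top
    (h : ∫⁻ b in Ioi (0 : ℝ), ∫⁻ a : ℝ,
      scoreSup f n ε a b ^ n * ENNReal.ofReal (weight n a b) < ∞) :
    ∫⁻ p, scoreOpenSup f n ε p ^ n ∂orbitMeasure n < ∞ := by
  rw [lintegral_orbitMeasure n (measurable_scoreOpenSup.pow_const n)]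
  refine lt_of_le_of_lt (setLIntegral_mono' measurableSet_Ioi fun b hb =>
    lintegral_mono fun a => ?_) h
  simp only
  rw [mul_comm]
  gcongr
  exact scoreOpenSup_le_scoreSup a hb

theorem abs_densityDeriv_div_le {p : ℝ × ℝ} (hp : 0 < p.2) (htop : scoreOpenSup f n ε p ≠ ∞)
    {z : ℝ} (hz : |z| < Real.sqrt n) :
    ∀ t ∈ Icc 0 ε, |densityDeriv f (p.1 + p.2 * z) t| / f (p.1 + p.2 * z) 0 ≤
      (scoreOpenSup f n ε p).toReal := by
  intro t ht
  have h1 : ENNReal.ofReal (|densityDeriv f (p.1 + p.2 * z) t| / f (p.1 + p.2 * z) 0) ≤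
      scoreOpenSup f n ε p :=
    (le_iSup₂ (f := fun (θ : ℝ) (_ : θ ∈ Icc 0 ε) =>
      ENNReal.ofReal (|densityDeriv f (p.1 + p.2 * z) θ| / f (p.1 + p.2 * z) 0)) t ht).trans
      (scoreEnvelope_le_scoreOpenSup p.1 hp hz)
  exact (ENNReal.ofReal_le_iff_le_toReal htop).1 h1

theorem ae_orbitMeasure_snd_pos : ∀ᵐ p ∂orbitMeasure n, 0 < p.2 :=
  (withDensity_absolutelyContinuous _ _).ae_le ae_snd_pos

theorem ae_scoreOpenSup_ne_top (hn : n ≠ 0)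
    (h : ∫⁻ p, scoreOpenSup f n ε p ^ n ∂orbitMeasure n < ∞) :
    ∀ᵐ p ∂orbitMeasure n, scoreOpenSup f n ε p ≠ ∞ := by
  filter_upwards [ae_lt_top (measurable_scoreOpenSup.pow_const n) h.ne] with p hp
  rintro htop
  simp [htop, hn] at hp

theorem integrable_one_add_scoreOpenSup_pow (hn : 2 ≤ n)
    (h : ∫⁻ p, scoreOpenSup f n ε p ^ n ∂orbitMeasure n < ∞) :
    Integrable (fun p => (1 + (scoreOpenSup f n ε p).toReal) ^ n) (orbitMeasure n) := by
  have : Fact (2 ≤ n) := ⟨hn⟩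
  have hm := (measurable_scoreOpenSup (f := f) (n := n) (ε := ε)).ennreal_toReal
  have hG : Integrable (fun p => (scoreOpenSup f n ε p).toReal ^ n) (orbitMeasure n) := by
    have := integrable_toReal_of_lintegral_ne_top
      (measurable_scoreOpenSup.pow_const n).aemeasurable h.ne
    simpa only [ENNReal.toReal_pow] using this
  -- The dominating function comes from `(1 + G) ^ n ≤ 2 ^ (n - 1) (1 + G ^ n)`; the constant is
  -- integrable because the orbit measure is finite.
  refine (((integrable_const (1 : ℝ)).add hG).const_mul (2 ^ (n - 1))).mono'
    ((measurable_const.add hm).pow_const n).aestronglyMeasurable (Eventually.of_forall fun p => ?_)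
  have hp : 0 ≤ (scoreOpenSup f n ε p).toReal := ENNReal.toReal_nonneg
  rw [Real.norm_of_nonneg (by positivity)]
  simpa using add_pow_le zero_le_one hp n

theorem abs_orbitRatio_sub_one_le (hf_pos : ∀ θ : ℝ, 0 ≤ θ → ∀ x, 0 < f x θ)
    (hf_smooth : ∀ x, ContDiffOn ℝ 1 (fun θ => Real.log (f x θ)) (Ici 0)) {p : ℝ × ℝ}
    (hp : 0 < p.2) (htop : scoreOpenSup f n ε p ≠ ∞) {z : Fin n → ℝ}
    (hz : ∀ i, |z i| < Real.sqrt n) {θ : ℝ} (hθ : θ ∈ Icc 0 ε) (hθ1 : θ ≤ 1) :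
    |orbitRatio f θ z p - 1| ≤ θ * (1 + (scoreOpenSup f n ε p).toReal) ^ n := by
  have hG : 0 ≤ (scoreOpenSup f n ε p).toReal := ENNReal.toReal_nonneg
  have h := abs_prod_sub_one_le Finset.univ (mul_nonneg hθ.1 hG) fun i _ =>
    abs_ratio_sub_one_le hf_pos hf_smooth (abs_densityDeriv_div_le hp htop (hz i)) hθ
  rw [Finset.card_fin] at h
  exact h.trans (one_add_mul_pow_sub_one_le ⟨hθ.1, hθ1⟩ hG n)

theorem abs_sum_score_le (hn : n ≠ 0) (hε : 0 ≤ ε) (hf_pos : ∀ θ : ℝ, 0 ≤ θ → ∀ x, 0 < f x θ)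
    (hf_smooth : ∀ x, ContDiffOn ℝ 1 (fun θ => Real.log (f x θ)) (Ici 0)) {p : ℝ × ℝ}
    (hp : 0 < p.2) (htop : scoreOpenSup f n ε p ≠ ∞) {z : Fin n → ℝ}
    (hz : ∀ i, |z i| < Real.sqrt n) :
    |∑ i, score f (p.1 + p.2 * z i) 0| ≤ n * (1 + (scoreOpenSup f n ε p).toReal) ^ n := by
  have hG : 0 ≤ (scoreOpenSup f n ε p).toReal := ENNReal.toReal_nonneg
  have h : ∀ i ∈ Finset.univ, |score f (p.1 + p.2 * z i) 0| ≤
      (1 + (scoreOpenSup f n ε p).toReal) ^ n := by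
    intro i _
    have h := abs_densityDeriv_div_le hp htop (hz i) 0 ⟨le_rfl, hε⟩
    have h0 := hf_pos 0 le_rfl (p.1 + p.2 * z i)
    rw [densityDeriv_eq_mul_score hf_pos hf_smooth _ le_rfl, abs_mul, abs_of_pos h0,
      mul_div_cancel_left₀ _ h0.ne'] at h
    calc _ ≤ 1 + (scoreOpenSup f n ε p).toReal := by linarith
      _ ≤ _ := le_self_pow₀ (by linarith) hn
  calc _ ≤ ∑ i, |score f (p.1 + p.2 * z i) 0| := Finset.abs_sum_le_sum_abs _ _
    _ ≤ _ := by simpa using Finset.sum_le_sum h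

end Envelope

/-- The regularity assumptions on the family of densities. -/
structure RegularFamily (f : ℝ → ℝ → ℝ) : Prop where
  meas : ∀ θ : ℝ, 0 ≤ θ → Measurable fun x => f x θ
  pos : ∀ θ : ℝ, 0 ≤ θ → ∀ x, 0 < f x θ
  prob : ∀ θ : ℝ, 0 ≤ θ → ∫⁻ x, ENNReal.ofReal (f x θ) = 1
  zero : ∀ x, f x 0 = gaussianPDFReal 0 1 x
  smooth : ∀ x, ContDiffOn ℝ 1 (fun θ => Real.log (f x θ)) (Ici 0)

/-! ### Power as an integral over samples and orbits. -/

section Power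

variable {f : ℝ → ℝ → ℝ} {n : ℕ} {φ ψ : (Fin n → ℝ) → ℝ}

theorem sampleLaw_zero_eq_withDensity (hf : RegularFamily f) :
    sampleLaw f n 0 0 1 =
      volume.withDensity fun x : Fin n → ℝ => ∏ i, ENNReal.ofReal (f (x i) 0) := by
  rw [sampleLaw_eq_withDensity (hf.meas 0 le_rfl) (hf.pos 0 le_rfl) (hf.prob 0 le_rfl) one_pos]
  simp [locScaleDensity]

theorem isProbabilityMeasure_sampleLaw_zero (hf : RegularFamily f) :
    IsProbabilityMeasure (sampleLaw f n 0 0 1) := by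
  have : IsProbabilityMeasure
      (volume.withDensity fun x => ENNReal.ofReal (locScaleDensity f 0 0 1 x)) := by
    refine ⟨?_⟩
    rw [withDensity_apply _ MeasurableSet.univ, Measure.restrict_univ]
    simpa [locScaleDensity] using hf.prob 0 le_rfl
  unfold sampleLaw
  infer_instance

theorem measurable_prod_density (hf : RegularFamily f) {θ : ℝ} (hθ : 0 ≤ θ) :
    Measurable fun x : Fin n → ℝ => ∏ i, ENNReal.ofReal (f (x i) θ) :=
  Finset.measurable_prod _ fun i _ => ((hf.meas θ hθ).comp (measurable_pi_apply i)).ennreal_ofReal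

/-- The null density is positive everywhere. Uniqueness is proved almost surely under the null law
and is transferred to Lebesgue measure by this. -/
theorem volume_absolutelyContinuous_sampleLaw_zero (hf : RegularFamily f) :
    (volume : Measure (Fin n → ℝ)) ≪ sampleLaw f n 0 0 1 := by
  rw [sampleLaw_zero_eq_withDensity hf]
  refine withDensity_absolutelyContinuous' (measurable_prod_density hf le_rfl).aemeasurable
    (Eventually.of_forall fun x => Finset.prod_ne_zero_iff.2 fun i _ => ?_)
  exact (ENNReal.ofReal_pos.2 (hf.pos 0 le_rfl _)).ne'

theorem power_congr_ae (hf : RegularFamily f) {θ a b : ℝ} (hθ : 0 ≤ θ) (hb : 0 < b)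
    (h : φ =ᵐ[volume] ψ) : power f φ θ a b = power f ψ θ a b := by
  refine integral_congr_ae (Measure.AbsolutelyContinuous.ae_eq ?_ h)
  rw [sampleLaw_eq_withDensity (hf.meas θ hθ) (hf.pos θ hθ) (hf.prob θ hθ) hb]
  exact withDensity_absolutelyContinuous _ _

theorem power_eq_toReal_lintegral (hf : RegularFamily f) (hφ : φ ∈ invariantTests n) {θ a b : ℝ}
    (hθ : 0 ≤ θ) (hb : 0 < b) :
    power f φ θ a b =
      (∫⁻ x, ENNReal.ofReal (φ x) * ∏ i, ENNReal.ofReal (f (x i) θ)).toReal := by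
  obtain ⟨hm, h01, hinv⟩ := hφ
  rw [power, integral_eq_lintegral_of_nonneg_ae (Eventually.of_forall fun x => (h01 x).1)
    hm.aestronglyMeasurable, lintegral_sampleLaw_of_invariant (hf.meas θ hθ) (hf.pos θ hθ)
    (hf.prob θ hθ) hb hm.ennreal_ofReal fun a b hb x => by rw [hinv a b hb]]

theorem power_eq_power_zero_one (hf : RegularFamily f) (hφ : φ ∈ invariantTests n) {θ a b : ℝ}
    (hθ : 0 ≤ θ) (hb : 0 < b) : power f φ θ a b = power f φ θ 0 1 := by
  rw [power_eq_toReal_lintegral hf hφ hθ hb, power_eq_toReal_lintegral hf hφ hθ one_pos]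

theorem measurable_orbitRatio_standardize (hf : RegularFamily f) {θ : ℝ} (hθ : 0 ≤ θ) :
    Measurable fun q : (Fin n → ℝ) × ℝ × ℝ => orbitRatio f θ (standardize q.1) q.2 :=
  measurable_orbitRatio (hf.meas θ hθ) (hf.meas 0 le_rfl)
    (measurable_standardize.comp measurable_fst) measurable_snd

/-- Here `θ` enters through the integrand only, which is what permits differentiation under the
integral. -/
theorem power_mul_orbitMeasure (hn : 2 ≤ n) (hf : RegularFamily f) (hφ : φ ∈ invariantTests n)
    {θ a b : ℝ} (hθ : 0 ≤ θ) (hb : 0 < b) :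
    power f φ θ a b * (orbitMeasure n).real univ =
      ∫ q, φ q.1 * orbitRatio f θ (standardize q.1) q.2
        ∂((sampleLaw f n 0 0 1).prod (orbitMeasure n)) := by
  have : Fact (2 ≤ n) := ⟨hn⟩
  have hm0 := measurable_prod_density (n := n) hf le_rfl
  have hmr := measurable_orbitRatio_standardize (n := n) hf hθ
  have hmq : Measurable fun q : (Fin n → ℝ) × ℝ × ℝ =>
      φ q.1 * orbitRatio f θ (standardize q.1) q.2 := (hφ.1.comp measurable_fst).mul hmr
  have hmr' : ∀ x : Fin n → ℝ, Measurable fun p => orbitRatio f θ (standardize x) p := fun x =>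
    hmr.comp (measurable_const.prodMk measurable_id)
  have h0 : ∀ (z : Fin n → ℝ) p, 0 ≤ orbitRatio f θ z p := fun z p =>
    Finset.prod_nonneg fun i _ => (div_pos (hf.pos θ hθ _) (hf.pos 0 le_rfl _)).le
  rw [power_eq_toReal_lintegral hf hφ hθ hb, measureReal_def, ← ENNReal.toReal_mul,
    lintegral_mul_likelihood_eq hn (hf.meas θ hθ) (hf.pos θ hθ) hf.zero hφ.1.ennreal_ofReal
      fun a b hb x => by rw [hφ.2.2 a b hb],
    integral_eq_lintegral_of_nonneg_ae
      (Eventually.of_forall fun q => mul_nonneg (hφ.2.1 _).1 (h0 _ _)) hmq.aestronglyMeasurable]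
  congr 1
  rw [lintegral_prod _ hmq.ennreal_ofReal.aemeasurable, sampleLaw_zero_eq_withDensity hf,
    lintegral_withDensity_eq_lintegral_mul _ hm0 hmq.ennreal_ofReal.lintegral_prod_right']
  refine lintegral_congr fun x => ?_
  simp only [Pi.mul_apply, ENNReal.ofReal_mul (hφ.2.1 x).1]
  rw [lintegral_const_mul _ (hmr' x).ennreal_ofReal]
  ring

end Power

/-! ### The slope of the power function at the null hypothesis. -/

section Slope

variable {f : ℝ → ℝ → ℝ} {n : ℕ} {φ ψ : (Fin n → ℝ) → ℝ}

theorem measurable_sum_score (hf : RegularFamily f) :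
    Measurable fun q : (Fin n → ℝ) × ℝ × ℝ =>
      ∑ i, score f (q.2.1 + q.2.2 * standardize q.1 i) 0 := by
  have hs := measurable_score hf.meas hf.smooth
  have hz := measurable_standardize (n := n)
  refine Finset.measurable_sum _ fun i _ => hs.comp (f := fun q : (Fin n → ℝ) × ℝ × ℝ =>
    q.2.1 + q.2.2 * standardize q.1 i) (by fun_prop)

/-- An integrable function that dominates the difference quotients of `orbitRatio` in `θ`, and the
score sums, uniformly in the sample. -/
theorem exists_integrable_bound (hn : 2 ≤ n) (hf : RegularFamily f)
    (hint : ScoreIntegrability f n) :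
    ∃ (D : ℝ × ℝ → ℝ) (ε : ℝ), 0 < ε ∧ Integrable D (orbitMeasure n) ∧
      ∀ᵐ p ∂orbitMeasure n, ∀ x : Fin n → ℝ,
        (∀ θ ∈ Ioc 0 ε, |orbitRatio f θ (standardize x) p - 1| ≤ θ * D p) ∧
        |∑ i, score f (p.1 + p.2 * standardize x i) 0| ≤ n * D p := by
  obtain ⟨ε, hε, h⟩ := hint
  have h' := lintegral_scoreOpenSup_pow_lt_top h
  -- The cap at 1 is what the convexity bound requires of `θ`.
  refine ⟨fun p => (1 + (scoreOpenSup f n ε p).toReal) ^ n, min ε 1, lt_min hε one_pos,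
    integrable_one_add_scoreOpenSup_pow hn h', ?_⟩
  filter_upwards [ae_orbitMeasure_snd_pos, ae_scoreOpenSup_ne_top (by omega) h'] with p hp htop x
  refine ⟨fun θ hθ => ?_, ?_⟩
  · exact abs_orbitRatio_sub_one_le hf.pos hf.smooth hp htop (abs_standardize_lt hn x)
      ⟨hθ.1.le, hθ.2.trans (min_le_left _ _)⟩ (hθ.2.trans (min_le_right _ _))
  · exact abs_sum_score_le (by omega) hε.le hf.pos hf.smooth hp htop (abs_standardize_lt hn x)

theorem integrable_sum_score (hn : 2 ≤ n) (hf : RegularFamily f) (hint : ScoreIntegrability f n)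
    (x : Fin n → ℝ) :
    Integrable (fun p : ℝ × ℝ => ∑ i, score f (p.1 + p.2 * standardize x i) 0)
      (orbitMeasure n) := by
  obtain ⟨D, ε, -, hD, hb⟩ := exists_integrable_bound hn hf hint
  refine (hD.const_mul n).mono' ((measurable_sum_score hf).comp
    (measurable_const.prodMk measurable_id : Measurable fun p : ℝ × ℝ => (x, p))).aestronglyMeasurable
    ?_
  filter_upwards [hb] with p hp using (hp x).2

theorem integrable_sum_score_mul_weight (hn : 2 ≤ n) (hf : RegularFamily f)
    (hint : ScoreIntegrability f n) (x : Fin n → ℝ) :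
    Integrable
      (fun p : ℝ × ℝ => (∑ i, score f (p.1 + p.2 * standardize x i) 0) * weight n p.1 p.2)
      (volume.prod (volume.restrict (Ioi 0))) := by
  have h := integrable_sum_score hn hf hint x
  rw [orbitMeasure, integrable_withDensity_iff (measurable_weight n).ennreal_ofReal
    (Eventually.of_forall fun p => ENNReal.ofReal_lt_top)] at h
  refine h.congr ?_
  filter_upwards [ae_snd_pos] with p hp
  rw [ENNReal.toReal_ofReal (weight_nonneg n p.1 hp.le)]

theorem integral_orbitMeasure_sum_score (hn : 2 ≤ n) (hf : RegularFamily f)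
    (hint : ScoreIntegrability f n) (x : Fin n → ℝ) :
    ∫ p, ∑ i, score f (p.1 + p.2 * standardize x i) 0 ∂orbitMeasure n =
      lbiStat f (standardize x) := by
  rw [lbiStat, orbitMeasure, integral_withDensity_eq_integral_toReal_smul
    (measurable_weight n).ennreal_ofReal (Eventually.of_forall fun p => ENNReal.ofReal_lt_top)]
  rw [← integral_prod_symm _ (integrable_sum_score_mul_weight hn hf hint x)]
  refine integral_congr_ae ?_
  filter_upwards [ae_snd_pos] with p hp
  rw [ENNReal.toReal_ofReal (weight_nonneg n p.1 hp.le), smul_eq_mul, mul_comm]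

theorem measurable_lbiStat_standardize (hn : 2 ≤ n) (hf : RegularFamily f)
    (hint : ScoreIntegrability f n) : Measurable fun x : Fin n → ℝ => lbiStat f (standardize x) := by
  have : Fact (2 ≤ n) := ⟨hn⟩
  simp_rw [← integral_orbitMeasure_sum_score hn hf hint]
  exact ((measurable_sum_score hf).stronglyMeasurable.integral_prod_right').measurable

theorem integrable_mul_sum_score (hn : 2 ≤ n) (hf : RegularFamily f)
    (hint : ScoreIntegrability f n) (hφ : φ ∈ invariantTests n) :
    Integrable (fun q : (Fin n → ℝ) × ℝ × ℝ =>
        φ q.1 * ∑ i, score f (q.2.1 + q.2.2 * standardize q.1 i) 0)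
      ((sampleLaw f n 0 0 1).prod (orbitMeasure n)) := by
  have : Fact (2 ≤ n) := ⟨hn⟩
  have := isProbabilityMeasure_sampleLaw_zero (n := n) hf
  obtain ⟨D, ε, -, hD, hb⟩ := exists_integrable_bound hn hf hint
  refine ((hD.const_mul n).comp_snd _).mono'
    ((hφ.1.comp measurable_fst).mul (measurable_sum_score hf)).aestronglyMeasurable ?_
  filter_upwards [Measure.quasiMeasurePreserving_snd.ae hb] with q hq
  rw [norm_mul, Real.norm_eq_abs, abs_of_nonneg (hφ.2.1 _).1]
  exact (mul_le_of_le_one_left (norm_nonneg _) (hφ.2.1 _).2).trans (hq q.1).2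

theorem integrable_mul_lbiStat (hn : 2 ≤ n) (hf : RegularFamily f)
    (hint : ScoreIntegrability f n) (hφ : φ ∈ invariantTests n) :
    Integrable (fun x => φ x * lbiStat f (standardize x)) (sampleLaw f n 0 0 1) := by
  have : Fact (2 ≤ n) := ⟨hn⟩
  have := isProbabilityMeasure_sampleLaw_zero (n := n) hf
  have h := (integrable_mul_sum_score hn hf hint hφ).integral_prod_left
  simpa only [integral_const_mul, integral_orbitMeasure_sum_score hn hf hint] using h

theorem hasDerivWithinAt_integral_orbitRatio (hn : 2 ≤ n) (hf : RegularFamily f)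
    (hint : ScoreIntegrability f n) (hφ : φ ∈ invariantTests n) :
    HasDerivWithinAt (fun θ => ∫ q, φ q.1 * orbitRatio f θ (standardize q.1) q.2
        ∂((sampleLaw f n 0 0 1).prod (orbitMeasure n)))
      (∫ x, φ x * lbiStat f (standardize x) ∂sampleLaw f n 0 0 1) (Ici 0) 0 := by
  have : Fact (2 ≤ n) := ⟨hn⟩
  have := isProbabilityMeasure_sampleLaw_zero (n := n) hf
  set μ := (sampleLaw f n 0 0 1).prod (orbitMeasure n)
  obtain ⟨D, ε, hε, hD, hb⟩ := exists_integrable_bound hn hf hint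
  have hDμ : Integrable (fun q : (Fin n → ℝ) × ℝ × ℝ => D q.2) μ := hD.comp_snd _
  have hbμ := (Measure.quasiMeasurePreserving_snd (μ := sampleLaw f n 0 0 1)).ae hb
  have hmφ : Measurable fun q : (Fin n → ℝ) × ℝ × ℝ => φ q.1 := hφ.1.comp measurable_fst
  have hbound : ∀ θ ∈ Ioc 0 ε, ∀ᵐ q ∂μ,
      ‖φ q.1 * (orbitRatio f θ (standardize q.1) q.2 - 1)‖ ≤ θ * D q.2 := fun θ hθ => by
    filter_upwards [hbμ] with q hq
    rw [norm_mul, Real.norm_eq_abs, abs_of_nonneg (hφ.2.1 _).1]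
    exact (mul_le_of_le_one_left (norm_nonneg _) (hφ.2.1 _).2).trans ((hq q.1).1 θ hθ)
  have hmeas : ∀ θ, 0 ≤ θ → AEStronglyMeasurable
      (fun q : (Fin n → ℝ) × ℝ × ℝ => φ q.1 * (orbitRatio f θ (standardize q.1) q.2 - 1)) μ :=
    fun θ hθ => (hmφ.mul
      ((measurable_orbitRatio_standardize hf hθ).sub_const 1)).aestronglyMeasurable
  have hφi : Integrable (fun q : (Fin n → ℝ) × ℝ × ℝ => φ q.1) μ :=
    (integrable_const (1 : ℝ)).mono' hmφ.aestronglyMeasurable (Eventually.of_forall fun q => by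
      rw [Real.norm_of_nonneg (hφ.2.1 _).1]
      exact (hφ.2.1 _).2)
  have hT : ∫ x, φ x * lbiStat f (standardize x) ∂sampleLaw f n 0 0 1 =
      ∫ q, φ q.1 * ∑ i, score f (q.2.1 + q.2.2 * standardize q.1 i) 0 ∂μ := by
    rw [integral_prod _ (integrable_mul_sum_score hn hf hint hφ)]
    simp only [integral_const_mul, integral_orbitMeasure_sum_score hn hf hint]
  rw [← hasDerivWithinAt_Ioi_iff_Ici, hasDerivWithinAt_iff_tendsto_slope' (by simp), hT]
  have hmem : ∀ᶠ θ in 𝓝[>] (0 : ℝ), θ ∈ Ioc 0 ε := Ioc_mem_nhdsGT hε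
  have hlim : Tendsto (fun θ => ∫ q, θ⁻¹ * (φ q.1 * (orbitRatio f θ (standardize q.1) q.2 - 1)) ∂μ)
      (𝓝[>] 0)
      (𝓝 (∫ q, φ q.1 * ∑ i, score f (q.2.1 + q.2.2 * standardize q.1 i) 0 ∂μ)) := by
    -- Subtracting 1 from the ratio makes the integrand `O(θ)`, so `D` alone dominates after
    -- division by `θ`.
    refine tendsto_integral_filter_of_dominated_convergence (fun q => D q.2) ?_ ?_ hDμ ?_
    · filter_upwards [hmem] with θ hθ using (hmeas θ hθ.1.le).const_mul _
    · filter_upwards [hmem] with θ hθ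
      filter_upwards [hbound θ hθ] with q hq
      rw [norm_mul, norm_inv, Real.norm_of_nonneg hθ.1.le, inv_mul_le_iff₀ hθ.1]
      exact hq
    · refine Eventually.of_forall fun q => ?_
      have h := (hasDerivWithinAt_orbitRatio hf.pos hf.smooth (standardize q.1) q.2).mono
        (Ioi_subset_Ici_self (a := 0))
      rw [hasDerivWithinAt_iff_tendsto_slope' (by simp)] at h
      refine (h.const_mul (φ q.1)).congr fun θ => ?_
      rw [slope_def_field, orbitRatio_zero hf.pos, sub_zero, div_eq_mul_inv]
      ring
  refine hlim.congr' ?_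
  filter_upwards [hmem] with θ hθ
  have hi : Integrable
      (fun q : (Fin n → ℝ) × ℝ × ℝ => φ q.1 * (orbitRatio f θ (standardize q.1) q.2 - 1)) μ :=
    (hDμ.const_mul θ).mono' (hmeas θ hθ.1.le) (hbound θ hθ)
  have hsum : ∫ q, φ q.1 * orbitRatio f θ (standardize q.1) q.2 ∂μ =
      ∫ q, φ q.1 * (orbitRatio f θ (standardize q.1) q.2 - 1) ∂μ + ∫ q, φ q.1 ∂μ := by
    rw [← integral_add hi hφi]
    exact integral_congr_ae (Eventually.of_forall fun q => by simp only; ring)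
  rw [integral_const_mul, slope_def_field, hsum]
  simp only [orbitRatio_zero hf.pos, mul_one, add_sub_cancel_right, sub_zero]
  rw [div_eq_inv_mul]

theorem hasDerivWithinAt_power (hn : 2 ≤ n) (hf : RegularFamily f)
    (hint : ScoreIntegrability f n) (hφ : φ ∈ invariantTests n) (a : ℝ) {b : ℝ} (hb : 0 < b) :
    HasDerivWithinAt (fun θ => power f φ θ a b)
      ((∫ x, φ x * lbiStat f (standardize x) ∂sampleLaw f n 0 0 1) / (orbitMeasure n).real univ)
      (Ici 0) 0 := by
  have : Fact (2 ≤ n) := ⟨hn⟩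
  have hW : (orbitMeasure n).real univ ≠ 0 :=
    ENNReal.toReal_ne_zero.2 ⟨orbitMeasure_univ_ne_zero n, measure_ne_top _ _⟩
  have h : ∀ θ ∈ Ici (0 : ℝ), power f φ θ a b =
      (∫ q, φ q.1 * orbitRatio f θ (standardize q.1) q.2
        ∂((sampleLaw f n 0 0 1).prod (orbitMeasure n))) / (orbitMeasure n).real univ :=
    fun θ hθ => by rw [eq_div_iff hW, power_mul_orbitMeasure hn hf hφ hθ hb]
  exact ((hasDerivWithinAt_integral_orbitRatio hn hf hint hφ).div_const _).congr h
    (h 0 (mem_Ici.2 le_rfl))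

end Slope

/-! ### The Neyman–Pearson argument and uniqueness. -/

section LocallyBest

variable {f : ℝ → ℝ → ℝ} {n : ℕ} {φ ψ : (Fin n → ℝ) → ℝ} {k : ℝ}

theorem invariantRegionTests_subset_invariantTests (n : ℕ) :
    invariantRegionTests n ⊆ invariantTests n := by
  rintro _ ⟨R, hR, hinv, rfl⟩
  refine ⟨measurable_const.indicator hR, fun x => ?_, fun a b hb x => ?_⟩
  · by_cases hx : x ∈ R <;> simp [regionTest, hx]
  · by_cases hx : x ∈ R
    · simp [regionTest, hx, (hinv a b hb x).1 hx]
    · simp [regionTest, hx, mt (hinv a b hb x).2 hx]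

theorem measurableSet_lbiRegion (hn : 2 ≤ n) (hf : RegularFamily f)
    (hint : ScoreIntegrability f n) : MeasurableSet (lbiRegion f n k) :=
  measurableSet_lt measurable_const (measurable_lbiStat_standardize hn hf hint)

theorem regionTest_lbiRegion_mem (hn : 2 ≤ n) (hf : RegularFamily f)
    (hint : ScoreIntegrability f n) :
    regionTest (lbiRegion f n k) ∈ invariantRegionTests n := by
  refine ⟨_, measurableSet_lbiRegion hn hf hint, fun a b hb x => ?_, rfl⟩
  simp only [lbiRegion, mem_ofPred_eq, standardize_affine (show n ≠ 0 by omega) a hb]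

theorem integrable_invariantTest (hf : RegularFamily f) (hφ : φ ∈ invariantTests n) :
    Integrable φ (sampleLaw f n 0 0 1) := by
  have := isProbabilityMeasure_sampleLaw_zero (n := n) hf
  refine (integrable_const (1 : ℝ)).mono' hφ.1.aestronglyMeasurable
    (Eventually.of_forall fun x => ?_)
  rw [Real.norm_of_nonneg (hφ.2.1 _).1]
  exact (hφ.2.1 _).2

/-- The Neyman–Pearson inequality for slopes, with its equality case. -/
theorem integral_mul_lbiStat_lt_or_ae_eq (hn : 2 ≤ n) (hf : RegularFamily f)
    (hint : ScoreIntegrability f n)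
    (hk : sampleLaw f n 0 0 1 {x | lbiStat f (standardize x) = k} = 0)
    (hψ : ψ ∈ invariantTests n)
    (hsize : power f ψ 0 0 1 = power f (regionTest (lbiRegion f n k)) 0 0 1) :
    ψ =ᵐ[volume] regionTest (lbiRegion f n k) ∨
      ∫ x, ψ x * lbiStat f (standardize x) ∂sampleLaw f n 0 0 1 <
        ∫ x, regionTest (lbiRegion f n k) x * lbiStat f (standardize x)
          ∂sampleLaw f n 0 0 1 := by
  set φ := regionTest (lbiRegion f n k) with hφdef
  have hφ : φ ∈ invariantTests n :=
    invariantRegionTests_subset_invariantTests n (regionTest_lbiRegion_mem hn hf hint)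
  set T := fun x : Fin n → ℝ => lbiStat f (standardize x) with hTdef
  have hi1 := integrable_mul_lbiStat hn hf hint hφ
  have hi2 := integrable_mul_lbiStat hn hf hint hψ
  have hj1 := integrable_invariantTest hf hφ
  have hj2 := integrable_invariantTest hf hψ
  -- Where `T > k` the region test is 1, the largest value of any test; elsewhere it is 0, the
  -- smallest.
  have hnn : ∀ x, 0 ≤ (φ x - ψ x) * (T x - k) := by
    intro x
    by_cases hx : k < T x
    · have : φ x = 1 := indicator_of_mem (show x ∈ lbiRegion f n k from hx) _
      exact mul_nonneg (by rw [this]; linarith [(hψ.2.1 x).2]) (by linarith)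
    · have : φ x = 0 := indicator_of_notMem (show x ∉ lbiRegion f n k from hx) _
      exact mul_nonneg_of_nonpos_of_nonpos (by rw [this]; linarith [(hψ.2.1 x).1]) (by linarith)
  have hexp : (fun x => (φ x - ψ x) * (T x - k)) =
      fun x => (φ x * T x - ψ x * T x) - k * (φ x - ψ x) := by ext x; ring
  have hi3 : Integrable (fun x => φ x * T x - ψ x * T x) (sampleLaw f n 0 0 1) := hi1.sub hi2
  have hj3 : Integrable (fun x => k * (φ x - ψ x)) (sampleLaw f n 0 0 1) :=
    (hj1.sub hj2).const_mul k
  have hint' : Integrable (fun x => (φ x - ψ x) * (T x - k)) (sampleLaw f n 0 0 1) := by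
    rw [hexp]; exact hi3.sub hj3
  have hval : ∫ x, (φ x - ψ x) * (T x - k) ∂sampleLaw f n 0 0 1 =
      ∫ x, φ x * T x ∂sampleLaw f n 0 0 1 - ∫ x, ψ x * T x ∂sampleLaw f n 0 0 1 := by
    have hs : ∫ x, ψ x ∂sampleLaw f n 0 0 1 = ∫ x, φ x ∂sampleLaw f n 0 0 1 := hsize
    rw [hexp, integral_sub hi3 hj3, integral_sub hi1 hi2,
      integral_const_mul, integral_sub hj1 hj2, hs, sub_self, mul_zero, sub_zero]
  rcases (integral_nonneg hnn : 0 ≤ ∫ x, (φ x - ψ x) * (T x - k) ∂sampleLaw f n 0 0 1).eq_or_lt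
    with h0 | h0
  · left
    have hz := (integral_eq_zero_iff_of_nonneg hnn hint').1 h0.symm
    refine (volume_absolutelyContinuous_sampleLaw_zero hf).ae_eq ?_
    -- Off the boundary `T = k` the vanishing product forces the two tests to agree, so there is
    -- nothing to randomize.
    have hk' : ∀ᵐ x ∂sampleLaw f n 0 0 1, T x ≠ k := measure_eq_zero_iff_ae_notMem.1 hk
    filter_upwards [hz, hk'] with x hx hxk
    have := (mul_eq_zero.1 hx).resolve_right (sub_ne_zero.2 hxk)
    linarith
  · right
    rw [hval] at h0
    linarith

theorem eventually_pos_of_hasDerivWithinAt {g : ℝ → ℝ} {d : ℝ}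
    (hg : HasDerivWithinAt g d (Ici 0) 0) (h : 0 < g 0 ∨ g 0 = 0 ∧ 0 < d) :
    ∀ᶠ θ in 𝓝[>] 0, 0 < g θ := by
  rcases h with h | ⟨h, hd⟩
  · exact (hg.continuousWithinAt.mono Ioi_subset_Ici_self).eventually (lt_mem_nhds h)
  · have hs := hg.mono (Ioi_subset_Ici_self (a := 0))
    rw [hasDerivWithinAt_iff_tendsto_slope' (by simp)] at hs
    filter_upwards [hs.eventually (lt_mem_nhds hd), self_mem_nhdsWithin] with θ hθ hpos
    rw [slope_def_field, h, sub_zero, sub_zero] at hθ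
    exact (div_pos_iff_of_pos_right hpos).1 hθ

/-- A competitor of smaller size loses near 0 by continuity of the power functions. One of equal
size loses by its strictly smaller slope, unless it agrees almost everywhere. -/
theorem ae_eq_or_power_lt (hn : 2 ≤ n) (hf : RegularFamily f)
    (hint : ScoreIntegrability f n)
    (hk : sampleLaw f n 0 0 1 {x | lbiStat f (standardize x) = k} = 0)
    (hψ : ψ ∈ invariantTests n)
    (hsize : power f ψ 0 0 1 ≤ power f (regionTest (lbiRegion f n k)) 0 0 1) :
    ψ =ᵐ[volume] regionTest (lbiRegion f n k) ∨
      ∀ᶠ θ in 𝓝[>] 0, power f ψ θ 0 1 < power f (regionTest (lbiRegion f n k)) θ 0 1 := by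
  have : Fact (2 ≤ n) := ⟨hn⟩
  have hW : 0 < (orbitMeasure n).real univ :=
    ENNReal.toReal_pos (orbitMeasure_univ_ne_zero n) (measure_ne_top _ _)
  have hφ := invariantRegionTests_subset_invariantTests n
    (regionTest_lbiRegion_mem (k := k) hn hf hint)
  have hd := (hasDerivWithinAt_power hn hf hint hφ 0 one_pos).sub
    (hasDerivWithinAt_power hn hf hint hψ 0 one_pos)
  rw [or_iff_not_imp_left]
  intro hne
  have hev := eventually_pos_of_hasDerivWithinAt hd ?_
  · filter_upwards [hev] with θ hθ
    exact sub_pos.1 hθ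
  · rcases hsize.lt_or_eq with h | h
    · exact Or.inl (sub_pos.2 h)
    · refine Or.inr ⟨sub_eq_zero.2 h.symm, ?_⟩
      have := (integral_mul_lbiStat_lt_or_ae_eq hn hf hint hk hψ h).resolve_left hne
      rw [← sub_div]
      exact div_pos (sub_pos.2 this) hW

theorem power_regionTest_lbiRegion (hn : 2 ≤ n) (hf : RegularFamily f)
    (hint : ScoreIntegrability f n) {a b : ℝ} (hb : 0 < b) :
    power f (regionTest (lbiRegion f n k)) 0 a b =
      (sampleLaw f n 0 0 1).real (lbiRegion f n k) := by
  rw [power_eq_power_zero_one hf (invariantRegionTests_subset_invariantTests n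
    (regionTest_lbiRegion_mem hn hf hint)) le_rfl hb, power, regionTest]
  exact integral_indicator_one (measurableSet_lbiRegion hn hf hint)

end LocallyBest

theorem theorem1 (n : ℕ) (hn : 2 ≤ n) (f : ℝ → ℝ → ℝ)
    -- for each `θ ≥ 0`, `f(·;θ)` is a positive probability density
    (hf_meas : ∀ θ : ℝ, 0 ≤ θ → Measurable fun x => f x θ)
    (hf_pos : ∀ θ : ℝ, 0 ≤ θ → ∀ x, 0 < f x θ)
    (hf_prob : ∀ θ : ℝ, 0 ≤ θ → ∫⁻ x, ENNReal.ofReal (f x θ) = 1)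
    -- `θ = 0` is the standard normal density
    (hf_zero : ∀ x, f x 0 = gaussianPDFReal 0 1 x)
    -- `log f(x;θ)` is continuously differentiable in `θ ∈ [0,∞)`, boundary included
    (hf_smooth : ∀ x, ContDiffOn ℝ 1 (fun θ => Real.log (f x θ)) (Ici 0))
    (hf_int : ScoreIntegrability f n)
    (k : ℝ) (hk : sampleLaw f n 0 0 1 {x | lbiStat f (standardize x) = k} = 0) :
    -- the integral defining `T` converges absolutely at every sample
    (∀ x : Fin n → ℝ, Integrable
      (fun p : ℝ × ℝ => (∑ i, score f (p.1 + p.2 * standardize x i) 0) * weight n p.1 p.2)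
      (volume.prod (volume.restrict (Ioi 0)))) ∧
    -- among invariant critical regions, and also among all invariant randomized tests, `T > k` is
    -- locally best at its size, in both senses, and is the only such test up to null sets
    ∀ C : Set ((Fin n → ℝ) → ℝ), C = invariantRegionTests n ∨ C = invariantTests n →
      ∀ α : ℝ, α = (sampleLaw f n 0 0 1).real (lbiRegion f n k) →
        (IsLocallyBest f C α (regionTest (lbiRegion f n k)) ∧
          ∀ φ, IsLocallyBest f C α φ → φ =ᵐ[volume] regionTest (lbiRegion f n k)) ∧
        (IsSlopeBest f C α (regionTest (lbiRegion f n k)) ∧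
          ∀ φ, IsSlopeBest f C α φ → φ =ᵐ[volume] regionTest (lbiRegion f n k)) := by
  have hf : RegularFamily f := ⟨hf_meas, hf_pos, hf_prob, hf_zero, hf_smooth⟩
  refine ⟨integrable_sum_score_mul_weight hn hf hf_int, fun C hC α hα => ?_⟩
  have : Fact (2 ≤ n) := ⟨hn⟩
  have hW : 0 < (orbitMeasure n).real univ :=
    ENNReal.toReal_pos (orbitMeasure_univ_ne_zero n) (measure_ne_top _ _)
  have hsub : C ⊆ invariantTests n := by
    rcases hC with rfl | rfl
    exacts [invariantRegionTests_subset_invariantTests n, subset_rfl]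
  have hmemC : regionTest (lbiRegion f n k) ∈ C := by
    have h := regionTest_lbiRegion_mem (k := k) hn hf hf_int
    rcases hC with rfl | rfl
    exacts [h, invariantRegionTests_subset_invariantTests n h]
  have hsize : HasExactSize f α (regionTest (lbiRegion f n k)) := fun a b hb => by
    rw [hα, power_regionTest_lbiRegion hn hf hf_int hb]
  have hlevel : HasLevel f α (regionTest (lbiRegion f n k)) := fun a b hb => (hsize a b hb).le
  have hslope : ∀ ψ ∈ C, HasExactSize f α ψ → ψ =ᵐ[volume] regionTest (lbiRegion f n k) ∨
      ∫ x, ψ x * lbiStat f (standardize x) ∂sampleLaw f n 0 0 1 <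
        ∫ x, regionTest (lbiRegion f n k) x * lbiStat f (standardize x)
          ∂sampleLaw f n 0 0 1 := fun ψ hψ hψα =>
    integral_mul_lbiStat_lt_or_ae_eq hn hf hf_int hk (hsub hψ)
      ((hψα 0 1 one_pos).trans (hsize 0 1 one_pos).symm)
  have hlocal : ∀ ψ ∈ C, HasLevel f α ψ → ψ =ᵐ[volume] regionTest (lbiRegion f n k) ∨
      ∀ᶠ θ in 𝓝[>] 0, power f ψ θ 0 1 < power f (regionTest (lbiRegion f n k)) θ 0 1 :=
    fun ψ hψ hψα => ae_eq_or_power_lt hn hf hf_int hk (hsub hψ)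
      ((hψα 0 1 one_pos).trans (hsize 0 1 one_pos).ge)
  refine ⟨⟨⟨hmemC, hlevel, fun ψ hψ hψα => ?_⟩, fun φ hφ => ?_⟩,
    ⟨⟨hmemC, hsize, fun ψ hψ hψα a b hb => ?_⟩, fun φ hφ => ?_⟩⟩
  · rcases hlocal ψ hψ hψα with h | h
    · exact ⟨1, one_pos, fun θ hθ a b hb => (power_congr_ae hf hθ.1.le hb h).le⟩
    · obtain ⟨δ, hδ, hsubset⟩ := mem_nhdsGT_iff_exists_Ioo_subset.1 h
      refine ⟨δ, hδ, fun θ hθ a b hb => ?_⟩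
      rw [power_eq_power_zero_one hf (hsub hψ) hθ.1.le hb,
        power_eq_power_zero_one hf (hsub hmemC) hθ.1.le hb]
      exact (hsubset hθ).le
  · obtain ⟨hφC, hφα, hbest⟩ := hφ
    refine (hlocal φ hφC hφα).resolve_right fun h => ?_
    obtain ⟨δ, hδ, hle⟩ := hbest _ hmemC hlevel
    -- A locally best `φ` must do at least as well as the region test near 0, so a single small `θ`
    -- with strictly smaller power is a contradiction.
    obtain ⟨θ, hθ, hθδ⟩ := (h.and (Ioo_mem_nhdsGT hδ)).exists
    exact (hle θ hθδ 0 1 one_pos).not_gt hθ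
  · refine ⟨_, _, hasDerivWithinAt_power hn hf hf_int (hsub hmemC) a hb,
      hasDerivWithinAt_power hn hf hf_int (hsub hψ) a hb, ?_⟩
    gcongr ?_ / _
    rcases hslope ψ hψ hψα with h | h
    · refine (integral_congr_ae ?_).le
      have hac : sampleLaw f n 0 0 1 ≪ volume := by
        rw [sampleLaw_zero_eq_withDensity hf]
        exact withDensity_absolutelyContinuous _ _
      filter_upwards [hac.ae_eq h] with x hx
      rw [hx]
    · exact h.le
  · obtain ⟨hφC, hφα, hbest⟩ := hφ
    refine (hslope φ hφC hφα).resolve_right fun h => ?_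
    obtain ⟨d, d', hd, hd', hle⟩ := hbest _ hmemC hsize 0 1 one_pos
    -- One-sided derivatives at the endpoint are unique, so the slopes given by optimality are the
    -- computed ones.
    have hu := uniqueDiffOn_Ici (0 : ℝ) 0 (mem_Ici.2 le_rfl)
    rw [hu.eq_deriv _ hd (hasDerivWithinAt_power hn hf hf_int (hsub hφC) 0 one_pos),
      hu.eq_deriv _ hd' (hasDerivWithinAt_power hn hf hf_int (hsub hmemC) 0 one_pos)] at hle
    exact hle.not_gt (div_lt_div_of_pos_right h hW)
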